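/- (Freudenthal Suspension Theorem) Let $n\ge 0$ be an integer and let $X$ be an $(n-1)$-connected CW complex with a base point $x_0\in X$, that is, $X$ is nonempty and $\pi_j(X,x)=0$ for all $0\le j\le n-1$ and all $x\in X$. Let $\Sigma X = X\wedge S^1 = (X\times I)/(X\times\partial I\cup\{x_0\}\times I)$, with $I=[0,1]$, be the reduced suspension, and let $$\Sigma:\pi_k(X,x_0)\to\pi_{k+1}(\Sigma X,*),\qquad [f]\mapsto[\Sigma f],\quad (\Sigma f)(y,t)=f(y)\wedge t \quad (y\in I^k,\ t\in I),$$ be the suspension map on homotopy classes of maps $f:(I^k,\partial I^k)\to(X,x_0)$, for $k\ge 0$. Then $\Sigma$ is a group homomorphism for every $k\ge 1$; it is an isomorphism for $0\le k\le 2n-2$ (a bijection of pointed sets if $k=0$), and it is surjective for $k=2n-1$ (if $k \geq 0$). -/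

import Mathlib

open scoped unitInterval Topology Topology.Homotopy

/-- A space `X` is `m`-connected (`m` an integer) if it is nonempty and `π_k(X, x)` is trivial for
every natural number `k ≤ m` and every base point `x`. So `(-1)`-connected means nonempty,
`0`-connected means path connected, `1`-connected means simply connected. -/
def IsNConnected (m : ℤ) (X : Type*) [TopologicalSpace X] : Prop :=
  Nonempty X ∧ ∀ k : ℕ, (k : ℤ) ≤ m → ∀ x : X, Subsingleton (π_ k X x)

section Suspension

variable {X : Type*} [TopologicalSpace X]

/-- The subspace `X × ∂I ∪ {x₀} × I` of `X × I`. -/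
def suspensionBase (x₀ : X) : Set (X × I) :=
  {p | p.2 = 0 ∨ p.2 = 1 ∨ p.1 = x₀}

/-- The equivalence relation on `X × I` that identifies all points of `X × ∂I ∪ {x₀} × I`. -/
def suspensionSetoid (x₀ : X) : Setoid (X × I) where
  r p q := p = q ∨ (p ∈ suspensionBase x₀ ∧ q ∈ suspensionBase x₀)
  iseqv :=
    { refl := fun _ => Or.inl rfl
      symm := by
        rintro p q (h | ⟨hp, hq⟩)
        · exact Or.inl h.symm
        · exact Or.inr ⟨hq, hp⟩
      trans := by
        rintro p q r (rfl | ⟨hp, hq⟩) h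
        · exact h
        · rcases h with rfl | ⟨_, hr⟩
          · exact Or.inr ⟨hp, hq⟩
          · exact Or.inr ⟨hp, hr⟩ }

/-- The reduced suspension `ΣX = X ∧ S¹ = (X × I) / (X × ∂I ∪ {x₀} × I)` of the based space
`(X, x₀)`, with `S¹ = I / ∂I` and the quotient topology. -/
def ReducedSuspension (x₀ : X) : Type _ :=
  Quotient (suspensionSetoid x₀)

instance (x₀ : X) : TopologicalSpace (ReducedSuspension x₀) :=
  inferInstanceAs (TopologicalSpace (Quotient (suspensionSetoid x₀)))

namespace ReducedSuspension

/-- The quotient map `X × I → ΣX`, `(x, t) ↦ x ∧ t`. -/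
def mk (x₀ : X) : C(X × I, ReducedSuspension x₀) where
  toFun p := Quotient.mk (suspensionSetoid x₀) p
  continuous_toFun := continuous_quotient_mk'

/-- The base point of `ΣX`. -/
def base (x₀ : X) : ReducedSuspension x₀ :=
  mk x₀ (x₀, 0)

theorem mk_eq_base {x₀ : X} {p : X × I} (hp : p ∈ suspensionBase x₀) : mk x₀ p = base x₀ :=
  Quotient.sound (Or.inr ⟨hp, Or.inl rfl⟩)

end ReducedSuspension

/-- The suspension of `f : (I^k, ∂I^k) → (X, x₀)`: the map `(I^(k+1), ∂I^(k+1)) → (ΣX, *)` that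
sends `(y, t)`, with `y ∈ I^k` and `t ∈ I` the last coordinate, to `f(y) ∧ t`. -/
def suspendGenLoop {k : ℕ} {x₀ : X} (f : Ω^ (Fin k) X x₀) :
    Ω^ (Fin (k + 1)) (ReducedSuspension x₀) (ReducedSuspension.base x₀) :=
  ⟨(ReducedSuspension.mk x₀).comp
      ⟨fun y => (f.1 (fun i => y i.castSucc), y (Fin.last k)), by fun_prop⟩, by
    rintro y ⟨i, hi⟩
    apply ReducedSuspension.mk_eq_base
    induction i using Fin.lastCases with
    | last => exact hi.elim Or.inl fun h => Or.inr (Or.inl h)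
    | cast j => exact Or.inr (Or.inr (f.2 _ ⟨j, hi⟩))⟩

theorem suspendGenLoop_homotopic {k : ℕ} {x₀ : X} {f g : Ω^ (Fin k) X x₀}
    (h : GenLoop.Homotopic f g) :
    GenLoop.Homotopic (suspendGenLoop f) (suspendGenLoop g) := by
  obtain ⟨H⟩ := h
  refine ⟨⟨⟨(ReducedSuspension.mk x₀).comp
    ⟨fun p => (H (p.1, fun i => p.2 i.castSucc), p.2 (Fin.last k)), by fun_prop⟩, ?_, ?_⟩, ?_⟩⟩
  · intro y
    simp [suspendGenLoop]
  · intro y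
    simp [suspendGenLoop]
  · rintro t y ⟨i, hi⟩
    refine Eq.trans ?_ ((suspendGenLoop f).2 y ⟨i, hi⟩).symm
    apply ReducedSuspension.mk_eq_base
    induction i using Fin.lastCases with
    | last => exact hi.elim Or.inl fun h => Or.inr (Or.inl h)
    | cast j =>
      exact Or.inr (Or.inr ((H.eq_fst t ⟨j, hi⟩).trans (f.2 _ ⟨j, hi⟩)))

/-- The suspension map `Σ : π_k(X, x₀) → π_{k+1}(ΣX, *)`, `[f] ↦ [Σf]`. -/
def suspensionMap (k : ℕ) (x₀ : X) :
    π_ k X x₀ → π_ (k + 1) (ReducedSuspension x₀) (ReducedSuspension.base x₀) :=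
  Quotient.map suspendGenLoop fun _ _ h => suspendGenLoop_homotopic h

end Suspension

/-!
The proof is Puppe's elementary one: no homology and no excision theorem is used.

Let `SX` be the unreduced suspension, with the open cones `U` (`UnreducedSuspension.lower`) and `V`
(`UnreducedSuspension.upper`) of the points of height less than `2/3` and greater than `1/3`. A map
from a cube to the reduced suspension is read as a family of paths in `SX` from `U` to `V`, and the
point is that such a family over a cube of dimension `m ≤ 2 n - 1` can be deformed, relative to the
boundary, until each path is constant at a point of the middle level `X × {1/2}`
(`exists_midpoint_family`). Applied to one loop in the suspension this gives surjectivity, and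
applied to a homotopy between two suspended loops, which has one parameter more, it gives
injectivity.

To deform the family, regard it as a map on a cube of dimension `m + 1`, the last coordinate being
the parameter of the paths, and subdivide into cubes so small that each is mapped to `U` or to `V`.
Both sets are contractible, and their intersection is, up to homotopy, `X`; since `X` is
`(n-1)`-connected, maps to `X` extend from the boundary of a ball of dimension at most `n`
(`sphereExtension_of_isNConnected`). So over the small cubes of dimension at most `n` the map can be
deformed into `U ∩ V`, and over the others the deformed map is pushed radially towards a corner of
the cube (`exists_corner_push`). As a result, the points that are not mapped to `V` have at least
`n + 1` coordinates in the lower halves of the unit intervals of the subdivision, and those that are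
not mapped to `U` have at least `n + 1` coordinates in the upper halves (`exists_general_position`).
One of these coordinates may be the last one; so if a path of the family leaves both `V` and `U`, at
least `n` of its `m` parameters lie in lower halves and at least `n` in upper halves, contrary to
`m < 2 n` (`not_nearCount_and_nearCount`). Hence each path lies in `U` or in `V`, and it can be shrunk
to one of its points in `U ∩ V`, chosen by a Urysohn function: the starting point if the path leaves
`U`, the end point if it leaves `V` (`exists_constant_family`).

It remains to pass between the two suspensions. A point of a CW complex is nondegenerate: there is a
retraction of `X × I` onto `X × {0} ∪ {x₀} × I` (`CWComplex.exists_retraction`). It gives a map from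
the reduced suspension to `SX` (`IsComparison`) which takes the base point to the midpoint over
`x₀`, and which becomes homotopic to the identity after the projection back to the reduced
suspension (`IsComparison.homotopic_toReduced`).
-/

/-! ### Extending maps cell by cell -/

/-- A space `K` is decomposed into closed cells `W c` with boundaries `B c`, the point `x` lying in
the interior of `W (cell x)`. If every map on the boundary of a cell whose values satisfy the
pointwise condition `P` extends over the cell with values that satisfy `P`, then there is a
continuous map on `K` with values that satisfy `P`. -/
theorem exists_continuous_of_cells {K ι Z : Type*} [TopologicalSpace K] [TopologicalSpace Z]
    [Nonempty Z] (dim : ι → ℕ) (W B : ι → Set K) (cell : K → ι)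
    (hmem : ∀ x, x ∈ W (cell x))
    (hcell : ∀ c x, x ∈ W c → x ∉ B c → cell x = c)
    (hlow : ∀ c x, x ∈ B c → dim (cell x) < dim c)
    (hB : ∀ c (g : K → Z), (∀ c', dim c' < dim c → ContinuousOn g (W c')) → ContinuousOn g (B c))
    (hglue : ∀ g : K → Z, (∀ c, ContinuousOn g (W c)) → Continuous g)
    (P : K → Z → Prop)
    (hstep : ∀ c (g : K → Z), ContinuousOn g (B c) → (∀ x ∈ B c, P x (g x)) →
      ∃ g' : K → Z, ContinuousOn g' (W c) ∧ Set.EqOn g' g (B c) ∧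
        ∀ x ∈ W c, x ∉ B c → P x (g' x)) :
    ∃ G : C(K, Z), ∀ x, P x (G x) := by
  classical
  have hle : ∀ c x, x ∈ W c → dim (cell x) ≤ dim c := fun c x hx => by
    by_cases h : x ∈ B c
    · exact (hlow c x h).le
    · rw [hcell c x hx h]
  let Q : ℕ → (K → Z) → Prop := fun d G =>
    (∀ c, dim c < d → ContinuousOn G (W c)) ∧ ∀ x, dim (cell x) < d → P x (G x)
  have step : ∀ d (G : {G // Q d G}), ∃ G' : {G // Q (d + 1) G},
      ∀ x, dim (cell x) < d → G'.1 x = G.1 x := by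
    rintro d ⟨G, hG1, hG2⟩
    have ext : ∀ c, ∃ g' : K → Z, dim c = d → ContinuousOn g' (W c) ∧ Set.EqOn g' G (B c) ∧
        ∀ x ∈ W c, x ∉ B c → P x (g' x) := fun c => by
      by_cases hc : dim c = d
      · obtain ⟨g', h⟩ := hstep c G (hB c G fun c' h => hG1 c' (hc ▸ h))
          fun x hx => hG2 x (hc ▸ hlow c x hx)
        exact ⟨g', fun _ => h⟩
      · exact ⟨G, fun h => absurd h hc⟩
    choose e he using ext
    let G' : K → Z := fun x => if dim (cell x) < d then G x else e (cell x) x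
    have hG'lt : ∀ x, dim (cell x) < d → G' x = G x := fun x hx => if_pos hx
    have hG'e : ∀ c, dim c = d → Set.EqOn G' (e c) (W c) := fun c hc x hx => by
      by_cases hb : x ∈ B c
      · rw [hG'lt x (hc ▸ hlow c x hb), (he c hc).2.1 hb]
      · have := hcell c x hx hb
        simp only [G', this, hc, lt_irrefl, if_false]
    refine ⟨⟨G', fun c hc => ?_, fun x hx => ?_⟩, hG'lt⟩
    · rcases Nat.lt_succ_iff_lt_or_eq.1 hc with h | h
      · exact (hG1 c h).congr fun x hx => hG'lt x ((hle c x hx).trans_lt h)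
      · exact (he c h).1.congr (hG'e c h)
    · rcases Nat.lt_succ_iff_lt_or_eq.1 hx with h | h
      · rw [hG'lt x h]; exact hG2 x h
      · rw [hG'e _ h (hmem x)]
        exact (he _ h).2.2 x (hmem x) fun hb => lt_irrefl _ (hlow _ _ hb)
  choose next hnext using step
  let G0 : {G // Q 0 G} := ⟨fun _ => Classical.arbitrary Z, by simp [Q]⟩
  let G : ∀ d, {G // Q d G} := fun d => Nat.rec G0 next d
  have hG : ∀ d k x, dim (cell x) < d → (G (d + k)).1 x = (G d).1 x := by
    intro d k x hx
    induction k with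
    | zero => rfl
    | succ k ih => exact (hnext (d + k) (G (d + k)) x (by omega)).trans ih
  let F : K → Z := fun x => (G (dim (cell x) + 1)).1 x
  refine ⟨⟨F, hglue F fun c => ?_⟩, fun x => (G _).2.2 x (Nat.lt_succ_self _)⟩
  refine ((G (dim c + 1)).2.1 c (Nat.lt_succ_self _)).congr fun x hx => ?_
  obtain ⟨k, hk⟩ := Nat.exists_eq_add_of_le (hle c x hx)
  rw [show dim c + 1 = dim (cell x) + 1 + k by omega, hG _ _ _ (Nat.lt_succ_self _)]

/-! ### The suspension map is a homomorphism -/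

theorem suspendGenLoop_apply {X : Type*} [TopologicalSpace X] {k : ℕ} {x₀ : X}
    (f : Ω^ (Fin k) X x₀) (y : Fin (k + 1) → I) :
    suspendGenLoop f y = ReducedSuspension.mk x₀ (f fun i => y i.castSucc, y (Fin.last k)) := rfl

theorem suspensionMap_mul {X : Type*} [TopologicalSpace X] (x₀ : X) (k : ℕ)
    (a b : π_ (k + 1) X x₀) :
    suspensionMap (k + 1) x₀ (a * b) = suspensionMap (k + 1) x₀ a * suspensionMap (k + 1) x₀ b := by
  induction a, b using Quotient.inductionOn₂ with
  | h f g =>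
    -- The product may be formed along any coordinate. Here the first one is used, as suspension
    -- appends a last one.
    have h1 := HomotopyGroup.mul_spec (i := (0 : Fin (k + 1))) (p := f) (q := g)
    have h2 := HomotopyGroup.mul_spec (i := (0 : Fin (k + 1)).castSucc) (p := suspendGenLoop f)
      (q := suspendGenLoop g)
    refine (congrArg (suspensionMap (k + 1) x₀) h1).trans (Eq.trans ?_ h2.symm)
    refine congrArg (Quotient.mk _) ?_
    ext y
    simp only [GenLoop.transAt, suspendGenLoop_apply, GenLoop.coe_copy]
    split_ifs with h
    all_goals
      congr 2
      · congr 1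
        funext i
        by_cases hi : i = 0
        · subst hi; simp
        · have : i.castSucc ≠ (0 : Fin (k + 1)).castSucc := fun h => hi (Fin.castSucc_injective _ h)
          rw [Function.update_of_ne hi, Function.update_of_ne this]

/-! ### Maps on balls -/

/-- The radial retraction of a normed space onto its closed unit ball. -/
noncomputable def ballClip {V : Type*} [NormedAddCommGroup V] [NormedSpace ℝ V] (v : V) : V :=
  (max 1 ‖v‖)⁻¹ • v

section ballClip

variable {V : Type*} [NormedAddCommGroup V] [NormedSpace ℝ V]

theorem continuous_ballClip : Continuous (ballClip : V → V) := by
  unfold ballClip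
  refine Continuous.smul (Continuous.inv₀ (by fun_prop) fun v => ?_) continuous_id
  positivity

theorem norm_ballClip_le (v : V) : ‖ballClip v‖ ≤ 1 := by
  have h : 0 < max 1 ‖v‖ := by positivity
  rw [ballClip, norm_smul, norm_inv, Real.norm_of_nonneg h.le, inv_mul_le_iff₀ h, mul_one]
  exact le_max_right _ _

theorem ballClip_of_norm_le {v : V} (hv : ‖v‖ ≤ 1) : ballClip v = v := by
  simp [ballClip, max_eq_left hv]

end ballClip

/-- A homotopy that is continuous over the closed unit ball only can be curried to a continuous map
on the whole normed space. -/
theorem exists_curry_of_continuousOn {V T : Type*} [NormedAddCommGroup V] [NormedSpace ℝ V]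
    [TopologicalSpace T] (F : V × I → T)
    (hF : ContinuousOn F (Metric.closedBall 0 1 ×ˢ Set.univ)) :
    ∃ G : C(V, C(I, T)), ∀ w, ‖w‖ ≤ 1 → ∀ s, G w s = F (w, s) := by
  have h : Continuous fun p : V × I => F (ballClip p.1, p.2) :=
    hF.comp_continuous (by have := continuous_ballClip (V := V); fun_prop)
      fun p => ⟨by simpa using norm_ballClip_le p.1, trivial⟩
  refine ⟨ContinuousMap.curry ⟨_, h⟩, fun w hw s => ?_⟩
  simp [ballClip_of_norm_le hw]

/-- The homotopy extension property of the unit sphere in the closed unit ball. -/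
theorem exists_ball_homotopy_extension {V T : Type*} [NormedAddCommGroup V] [NormedSpace ℝ V]
    [TopologicalSpace T] (a : V → T) (ha : ContinuousOn a (Metric.closedBall 0 1))
    (c : V → C(I, T)) (hc : ContinuousOn c (Metric.sphere 0 1))
    (hac : ∀ w, ‖w‖ = 1 → c w 0 = a w) :
    ∃ G : C(V, C(I, T)), (∀ w, ‖w‖ ≤ 1 → G w 0 = a w) ∧ (∀ w, ‖w‖ = 1 → G w = c w) ∧
      ∀ w, ‖w‖ ≤ 1 → ∀ s, (∃ w', ‖w'‖ ≤ 1 ∧ G w s = a w') ∨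
        ∃ w' s', ‖w'‖ = 1 ∧ G w s = c w' s' := by
  classical
  -- The cylinder is projected from the point at height `2` onto its base and its lateral side.
  let m : V × I → ℝ := fun p => max ‖p.1‖ (1 - (p.2 : ℝ) / 2)
  have hm : Continuous m := by fun_prop
  have hm0 : ∀ p, 0 < m p := fun p =>
    lt_max_of_lt_right (by have := p.2.2.2; linarith)
  let r : V × I → V := fun p => (m p)⁻¹ • p.1
  have hr : Continuous r := (hm.inv₀ fun p => (hm0 p).ne').smul continuous_fst
  have hr1 : ∀ p, ‖r p‖ ≤ 1 := fun p => by
    rw [norm_smul, norm_inv, Real.norm_of_nonneg (hm0 p).le, inv_mul_le_iff₀ (hm0 p), mul_one]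
    exact le_max_left _ _
  have hr2 : ∀ p : V × I, 1 - (p.2 : ℝ) / 2 ≤ ‖p.1‖ → ‖r p‖ = 1 := fun p hp => by
    have : m p = ‖p.1‖ := max_eq_left hp
    have h0 := hm0 p
    rw [norm_smul, norm_inv, Real.norm_of_nonneg h0.le, this, inv_mul_cancel₀ (this ▸ h0.ne')]
  let η : V × I → I := fun p => Set.projIcc (0 : ℝ) 1 zero_le_one (2 - (2 - p.2) / m p)
  have hη : Continuous η := continuous_projIcc.comp
    (continuous_const.sub ((by fun_prop : Continuous fun p : V × I => (2 - (p.2 : ℝ))).div hm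
      fun p => (hm0 p).ne'))
  let A : Set (V × I) := {p | ‖p.1‖ ≤ 1 - (p.2 : ℝ) / 2}
  let A' : Set (V × I) := {p | 1 - (p.2 : ℝ) / 2 ≤ ‖p.1‖}
  have hA : IsClosed A := isClosed_le (by fun_prop) (by fun_prop)
  have hA' : IsClosed A' := isClosed_le (by fun_prop) (by fun_prop)
  let F : V × I → T := fun p => if p ∈ A then a (r p) else c (r p) (η p)
  have hFA : ∀ p ∈ A, F p = a (r p) := fun p hp => if_pos hp
  have hFA' : ∀ p ∈ A', F p = c (r p) (η p) := fun p hp => by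
    by_cases h : p ∈ A
    · rw [hFA p h]
      have hmp : m p = 1 - (p.2 : ℝ) / 2 := max_eq_right h
      have h0 := hm0 p
      have : η p = 0 := by
        have h2 : 2 - (2 - (p.2 : ℝ)) / m p = 0 := by
          rw [hmp] at h0 ⊢
          rw [show 2 - (p.2 : ℝ) = 2 * (1 - p.2 / 2) by ring, mul_div_assoc, div_self h0.ne']
          norm_num
        simp only [η, h2]
        exact Set.projIcc_left zero_le_one
      rw [this, hac _ (hr2 p hp)]
    · exact if_neg h
  have hF : Continuous F := by
    have h1 : ContinuousOn F A := ((ha.comp_continuous hr fun p => by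
      simpa using hr1 p).continuousOn (s := A)).congr hFA
    have h2 : ContinuousOn F A' := by
      have hcr : ContinuousOn (fun p => c (r p)) A' :=
        hc.comp hr.continuousOn fun p hp => by simpa using hr2 p hp
      exact (hcr.eval hη.continuousOn).congr hFA'
    rw [← continuousOn_univ]
    refine (h1.union_of_isClosed h2 hA hA').mono fun p _ => le_total ‖p.1‖ (1 - (p.2 : ℝ) / 2)
  refine ⟨ContinuousMap.curry ⟨F, hF⟩, fun w hw => ?_, fun w hw => ?_, fun w hw s => ?_⟩
  · have hA0 : (w, (0 : I)) ∈ A := by simpa [A] using hw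
    have : r (w, 0) = w := by simp [r, m, hw]
    change F (w, 0) = a w
    rw [hFA _ hA0, this]
  · ext s
    have hs := s.2.1
    have hA0 : (w, s) ∈ A' := by
      change 1 - (s : ℝ) / 2 ≤ ‖w‖
      linarith
    have hm1 : m (w, s) = 1 := by
      simp only [m, hw]; exact max_eq_left (by linarith)
    have h1 : r (w, s) = w := by simp [r, hm1]
    have h2 : η (w, s) = s := by
      simp only [η, hm1]
      rw [show 2 - (2 - (s : ℝ)) / 1 = s by ring]
      exact Set.projIcc_val _ s
    change F (w, s) = c w s
    rw [hFA' _ hA0, h1, h2]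
  · change (∃ w', _ ∧ F (w, s) = _) ∨ ∃ w' s', _ ∧ F (w, s) = _
    rcases le_total ‖w‖ (1 - (s : ℝ) / 2) with h | h
    · exact Or.inl ⟨_, hr1 _, hFA (w, s) h⟩
    · exact Or.inr ⟨_, _, hr2 (w, s) h, hFA' (w, s) h⟩

/-- A motion of the unit ball of `Fin d → ℝ` that raises the interior point `w₀` along the second
coordinate and draws a neighbourhood of `w₀` after it: the points of the neighbourhood first move
straight towards `w₀` at height `0`. -/
theorem exists_ball_whisker {d : ℕ} (w₀ : Fin d → ℝ) (h₀ : ‖w₀‖ < 1) :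
    ∃ R : C((Fin d → ℝ) × I, (Fin d → ℝ) × I),
      (∀ w s, ‖w‖ ≤ 1 → ‖(R (w, s)).1‖ ≤ 1) ∧ (∀ w s, ‖w‖ = 1 → R (w, s) = (w, 0)) ∧
      (∀ w, R (w, 0) = (w, 0)) ∧ (∀ s, R (w₀, s) = (w₀, s)) ∧
      ∀ w s, (R (w, s)).2 = 0 ∨ (R (w, s)).1 = w₀ := by
  obtain ⟨ε, hε, hε1⟩ : ∃ ε : ℝ, 0 < ε ∧ ε ≤ 1 - ‖w₀‖ := ⟨1 - ‖w₀‖, by linarith, le_rfl⟩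
  -- `ρ` measures the distance to `w₀`. The motion takes place where `ρ ≤ 1`: each coordinate is
  -- moved towards that of `w₀` by at most `τ`, and wherever the height `s - 2 * ρ` is positive, `τ`
  -- is large enough for the point to have reached `w₀`.
  let ρ : (Fin d → ℝ) → ℝ := fun w => ‖w - w₀‖ / ε
  have hρ : Continuous ρ := by fun_prop
  let τ : (Fin d → ℝ) × I → ℝ := fun p => ε * max 0 (min ((p.2 : ℝ) / 2) (1 - ρ p.1))
  have hτ : Continuous τ := by fun_prop
  have hτ0 : ∀ p, 0 ≤ τ p := fun p => by positivity
  let R : (Fin d → ℝ) × I → (Fin d → ℝ) × I := fun p =>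
    (fun i => p.1 i - max (-τ p) (min (p.1 i - w₀ i) (τ p)),
      Set.projIcc 0 1 zero_le_one (p.2 - 2 * ρ p.1))
  have hR : Continuous R := by
    refine Continuous.prodMk (by fun_prop) (continuous_projIcc.comp (by fun_prop))
  have hfar : ∀ w s, 1 ≤ ρ w → R (w, s) = (w, 0) := fun w s h => by
    have : τ (w, s) = 0 := by
      simp only [τ]
      rw [max_eq_left ((min_le_right _ _).trans (by linarith)), mul_zero]
    refine Prod.ext (funext fun i => ?_) (Set.projIcc_of_le_left zero_le_one ?_)
    · simp only [R, this, neg_zero, sub_eq_self]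
      exact max_eq_left (min_le_right _ _)
    · have := s.2.2
      simp only
      linarith
  have hw : ∀ w, ‖w‖ = 1 → 1 ≤ ρ w := fun w hw => by
    rw [le_div_iff₀ hε]
    have := norm_sub_norm_le w w₀
    linarith
  refine ⟨⟨R, hR⟩, fun w s hws => ?_, fun w s h => hfar w s (hw w h), fun w => ?_, fun s => ?_,
    fun w s => ?_⟩
  · rcases le_total 1 (ρ w) with h | h
    · change ‖(R (w, s)).1‖ ≤ 1
      rw [hfar w s h]
      exact hws
    · have h1 : ‖w - w₀‖ ≤ ε := by
        rwa [div_le_one hε] at h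
      refine (pi_norm_le_iff_of_nonneg zero_le_one).2 fun i => ?_
      have h2 : |w i - w₀ i| ≤ ε := (norm_le_pi_norm (w - w₀) i).trans h1
      have h3 : |w₀ i| ≤ ‖w₀‖ := norm_le_pi_norm w₀ i
      have h4 := hτ0 (w, s)
      change |w i - max (-τ (w, s)) (min (w i - w₀ i) (τ (w, s)))| ≤ 1
      rw [abs_le] at *
      generalize τ (w, s) = t at *
      constructor
      · rcases max_cases (-t) (min (w i - w₀ i) t) with h | h <;>
          rcases min_cases (w i - w₀ i) t with h' | h' <;> linarith
      · rcases max_cases (-t) (min (w i - w₀ i) t) with h | h <;>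
          rcases min_cases (w i - w₀ i) t with h' | h' <;> linarith
  · have h0 : 0 ≤ ρ w := by positivity
    have : τ (w, 0) ≤ 0 := by
      simp only [τ]
      refine mul_nonpos_of_nonneg_of_nonpos hε.le (max_le le_rfl ((min_le_left _ _).trans ?_))
      simp
    have : τ (w, 0) = 0 := le_antisymm this (hτ0 _)
    refine Prod.ext (funext fun i => ?_) (Set.projIcc_of_le_left zero_le_one ?_)
    · simp only [R, this, ContinuousMap.coe_mk, neg_zero, sub_eq_self]
      exact max_eq_left (min_le_right _ _)
    · simp only [Set.Icc.coe_zero]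
      linarith
  · have h0 : ρ w₀ = 0 := by simp [ρ]
    refine Prod.ext (funext fun i => ?_) ?_
    · have := hτ0 (w₀, s)
      simp [R, this]
    · simp [R, h0]
  · by_cases h : (s : ℝ) ≤ 2 * ρ w
    · exact Or.inl (Set.projIcc_of_le_left zero_le_one (by simp only; linarith))
    · right
      push Not at h
      have hs := s.2.2
      have h2 : ‖w - w₀‖ ≤ τ (w, s) := by
        have : ‖w - w₀‖ = ε * ρ w := by simp only [ρ]; field_simp
        rw [this]
        refine mul_le_mul_of_nonneg_left (le_max_of_le_right (le_min ?_ ?_)) hε.le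
        · simp only; linarith
        · simp only; linarith
      funext i
      have h3 : |w i - w₀ i| ≤ τ (w, s) := (norm_le_pi_norm (w - w₀) i).trans h2
      rw [abs_le] at h3
      change w i - max (-τ (w, s)) (min (w i - w₀ i) (τ (w, s))) = w₀ i
      rw [min_eq_left h3.2, max_eq_right h3.1]
      ring

/-! ### Points of CW complexes are nondegenerate -/

section CW

open Topology CWComplex Metric

variable {X : Type*} [TopologicalSpace X] [T2Space X] [CWComplex (Set.univ : Set X)]

/-- A map on the closed unit ball that factors on the sphere through the characteristic map of a
cell descends to the closed cell. -/
theorem exists_continuousOn_closedCell {Z : Type*} [TopologicalSpace Z] {d : ℕ}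
    (e : cell (Set.univ : Set X) d) (F : C(Fin d → ℝ, Z)) (g : X → Z)
    (hg : ∀ w, ‖w‖ = 1 → F w = g (map d e w)) :
    ∃ g' : X → Z, ContinuousOn g' (closedCell d e) ∧ Set.EqOn g' g (cellFrontier d e) ∧
      ∀ w, ‖w‖ < 1 → g' (map d e w) = F w := by
  classical
  let g' : X → Z := fun x => if x ∈ cellFrontier d e then g x else F ((map d e).symm x)
  have h1 : Set.EqOn g' g (cellFrontier d e) := fun x hx => if_pos hx
  have h2 : ∀ w, ‖w‖ < 1 → g' (map d e w) = F w := fun w hw => by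
    have hw' : w ∈ ball (0 : Fin d → ℝ) 1 := by simpa using hw
    have hopen : map d e w ∈ openCell d e := ⟨w, hw', rfl⟩
    have hn : map d e w ∉ cellFrontier d e := fun h =>
      (disjoint_skeletonLT_openCell (C := (Set.univ : Set X)) (n := d) (j := e) le_rfl).le_bot
        ⟨cellFrontier_subset_skeletonLT d e h, hopen⟩
    simp only [g', hn, if_false]
    rw [(map d e).left_inv]
    rwa [source_eq]
  have h3 : ∀ w ∈ closedBall (0 : Fin d → ℝ) 1, g' (map d e w) = F w := fun w hw => by
    rcases (show ‖w‖ ≤ 1 by simpa using hw).lt_or_eq with h | h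
    · exact h2 w h
    · rw [hg w h, h1 ⟨w, by simpa using h, rfl⟩]
  refine ⟨g', continuousOn_iff_isClosed.2 fun t ht => ?_, h1, h2⟩
  refine ⟨map d e '' (closedBall 0 1 ∩ F ⁻¹' t), ?_, ?_⟩
  · refine IsCompact.isClosed (IsCompact.image_of_continuousOn ?_
      ((RelCWComplex.continuousOn d e).mono Set.inter_subset_left))
    exact (isCompact_closedBall _ _).inter_right (ht.preimage F.continuous)
  · ext x
    constructor
    · rintro ⟨hx, w, hw, rfl⟩
      exact ⟨⟨w, ⟨hw, by simpa [h3 w hw] using hx⟩, rfl⟩, w, hw, rfl⟩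
    · rintro ⟨⟨w, ⟨hw, hx⟩, rfl⟩, h⟩
      exact ⟨by simpa [h3 w hw] using hx, h⟩

/-- A point `x₀` of a CW complex `X` is nondegenerate: the cylinder `X × I` retracts onto
`X × {0} ∪ {x₀} × I`. -/
theorem CWComplex.exists_retraction (x₀ : X) :
    ∃ R : C(X × I, X × I), (∀ p, (R p).2 = 0 ∨ (R p).1 = x₀) ∧ (∀ x, R (x, 0) = (x, 0)) ∧
      ∀ s, R (x₀, s) = (x₀, s) := by
  classical
  have hcell : ∀ x : X, ∃ c : Σ n, cell (Set.univ : Set X) n, x ∈ openCell c.1 c.2 := fun x => by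
    have : x ∈ ⋃ (n : ℕ) (j : cell (Set.univ : Set X) n), openCell n j := by
      rw [iUnion_openCell_eq_complex]; trivial
    simp only [Set.mem_iUnion] at this
    obtain ⟨n, j, h⟩ := this
    exact ⟨⟨n, j⟩, h⟩
  choose κ hκ using hcell
  have huniq : ∀ c x, x ∈ openCell c.1 c.2 → κ x = c := fun c x hx =>
    eq_of_not_disjoint_openCell (Set.not_disjoint_iff.2 ⟨x, hκ x, hx⟩)
  obtain ⟨d, e₀, hκ0⟩ : ∃ d e₀, κ x₀ = ⟨d, e₀⟩ := ⟨_, _, rfl⟩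
  obtain ⟨w₀, hw₀, hx₀⟩ : ∃ w₀ : Fin d → ℝ, ‖w₀‖ < 1 ∧ map d e₀ w₀ = x₀ := by
    have := hκ x₀
    rw [hκ0] at this
    obtain ⟨w, hw, h⟩ := this
    exact ⟨w, by simpa using hw, h⟩
  -- The homotopy is built as a map to the path space; it is stationary on the cells whose dimension
  -- is less than that of the cell of `x₀`.
  let P : X → C(I, X × I) → Prop := fun x ω =>
    (∀ s, (ω s).2 = 0 ∨ (ω s).1 = x₀) ∧ ω 0 = (x, 0) ∧ (x = x₀ → ∀ s, ω s = (x₀, s)) ∧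
      ((κ x).1 < d → ∀ s, ω s = (x, 0))
  have : Nonempty C(I, X × I) := ⟨ContinuousMap.const _ (x₀, 0)⟩
  have hopen : ∀ (c : Σ n, cell (Set.univ : Set X) n) (x : X), x ∈ closedCell c.1 c.2 →
      x ∉ cellFrontier c.1 c.2 → x ∈ openCell c.1 c.2 := fun c x hx hb => by
    rw [← cellFrontier_union_openCell_eq_closedCell] at hx
    exact hx.resolve_left hb
  have hlow : ∀ (c : Σ n, cell (Set.univ : Set X) n) (x : X), x ∈ cellFrontier c.1 c.2 →
      (κ x).1 < c.1 := fun c x hx => by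
    obtain ⟨m, hm, j, hj⟩ := mem_skeletonLT_iff.1 (cellFrontier_subset_skeletonLT c.1 c.2 hx)
    rw [huniq ⟨m, j⟩ x hj]
    exact_mod_cast hm
  obtain ⟨G, hG⟩ := exists_continuous_of_cells (K := X) (Z := C(I, X × I))
    (ι := Σ n, cell (Set.univ : Set X) n) (fun c => c.1) (fun c => closedCell c.1 c.2)
    (fun c => cellFrontier c.1 c.2) κ (fun x => openCell_subset_closedCell _ _ (hκ x))
    (fun c x hx hb => huniq c x (hopen c x hx hb)) hlow
    (fun c g hg => by
      obtain ⟨J, hJ⟩ := cellFrontier_subset_finite_closedCell c.1 c.2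
      let S : (Σ m : Fin c.1, {j // j ∈ J m}) → Set X := fun q => closedCell q.1.1 q.2.1
      have : ContinuousOn g (⋃ q, S q) := (locallyFinite_of_finite S).continuousOn_iUnion
        (fun q => isClosed_closedCell) fun q => hg ⟨_, q.2.1⟩ q.1.2
      refine this.mono fun x hx => ?_
      have := hJ hx
      simp only [Set.mem_iUnion] at this ⊢
      obtain ⟨m, hm, j, hj, hxj⟩ := this
      exact ⟨⟨⟨m, hm⟩, ⟨j, hj⟩⟩, hxj⟩)
    (fun g hg => by
      refine continuous_iff_isClosed.2 fun t ht => (CWComplex.closed (Set.univ : Set X) _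
        (Set.subset_univ _)).2 fun n j => ?_
      have := (hg ⟨n, j⟩).preimage_isClosed_of_isClosed isClosed_closedCell ht
      rwa [Set.inter_comm] at this)
    P
    (fun c g hgc hgP => by
      obtain ⟨n, e⟩ := c
      have hχ := RelCWComplex.continuousOn (C := (Set.univ : Set X)) n e
      by_cases hc : (⟨n, e⟩ : Σ n, cell (Set.univ : Set X) n) = ⟨d, e₀⟩
      · cases hc
        obtain ⟨R, hR1, hR2, hR3, hR4, hR5⟩ := exists_ball_whisker w₀ hw₀
        obtain ⟨F, hF⟩ := exists_curry_of_continuousOn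
          (fun p => (map d e₀ (R p).1, (R p).2) : (Fin d → ℝ) × I → X × I) (by
            refine ContinuousOn.prodMk (hχ.comp (by fun_prop) fun p hp => ?_) (by fun_prop)
            have := hR1 p.1 p.2 (by simpa using hp.1)
            simpa using this)
        obtain ⟨g', h1, h2, h3⟩ := exists_continuousOn_closedCell e₀ F g fun w hw => by
          have hxw : map d e₀ w ∈ cellFrontier d e₀ := ⟨w, by simpa using hw, rfl⟩
          ext1 s
          rw [hF w hw.le, hR2 w s hw, (hgP _ hxw).2.2.2 (hlow ⟨d, e₀⟩ _ hxw)]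
        refine ⟨g', h1, h2, fun x hx hb => ?_⟩
        obtain ⟨w, hw, rfl⟩ := hopen ⟨d, e₀⟩ x hx hb
        have hw1 : ‖w‖ < 1 := by simpa using hw
        have hκx := huniq ⟨d, e₀⟩ _ (hopen ⟨d, e₀⟩ _ hx hb)
        simp only [h3 w hw1]
        refine ⟨fun s => ?_, ?_, fun hxx s => ?_, fun hlt => ?_⟩
        · rw [hF w hw1.le]
          exact (hR5 w s).imp id fun h => by simp only [h, hx₀]
        · rw [hF w hw1.le, hR3]
        · have : w = w₀ := by
            refine (map d e₀).injOn ?_ ?_ (hxx.trans hx₀.symm) <;> rw [source_eq] <;> simpa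
          rw [hF w hw1.le, this, hR4, hx₀]
        · rw [hκx] at hlt
          exact absurd hlt (lt_irrefl _)
      · have hne : ∀ x ∈ openCell n e, x ≠ x₀ := fun x hx h =>
          hc ((huniq ⟨n, e⟩ x hx).symm.trans (h ▸ hκ0))
        obtain ⟨F, hF⟩ : ∃ F : C(Fin n → ℝ, C(I, X × I)),
            (∀ w, ‖w‖ = 1 → F w = g (map n e w)) ∧ ∀ w, ‖w‖ < 1 →
              (∀ s, (F w s).2 = 0 ∨ (F w s).1 = x₀) ∧ F w 0 = (map n e w, 0) ∧
              (n < d → ∀ s, F w s = (map n e w, 0)) := by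
          by_cases hn : n < d
          · obtain ⟨F, hF⟩ := exists_curry_of_continuousOn
              (fun p => (map n e p.1, 0) : (Fin n → ℝ) × I → X × I)
              (ContinuousOn.prodMk (hχ.comp continuousOn_fst fun p hp => hp.1)
                continuousOn_const)
            refine ⟨F, fun w hw => ?_, fun w hw => ⟨fun s => ?_, hF w hw.le 0,
              fun _ => hF w hw.le⟩⟩
            · have hxw : map n e w ∈ cellFrontier n e := ⟨w, by simpa using hw, rfl⟩
              ext1 s
              rw [hF w hw.le, (hgP _ hxw).2.2.2 ((hlow ⟨n, e⟩ _ hxw).trans hn)]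
            · left; rw [hF w hw.le]
          · obtain ⟨F, hF1, hF2, hF3⟩ := exists_ball_homotopy_extension
              (fun w => ((map n e w, 0) : X × I)) (hχ.prodMk continuousOn_const)
              (fun w => g (map n e w))
              (hgc.comp (hχ.mono sphere_subset_closedBall) fun w hw => ⟨w, hw, rfl⟩)
              (fun w hw => (hgP _ ⟨w, by simpa using hw, rfl⟩).2.1)
            refine ⟨F, hF2, fun w hw => ⟨fun s => ?_, hF1 w hw.le, fun h => absurd h hn⟩⟩
            obtain ⟨w', _, h⟩ | ⟨w', s', hw', h⟩ := hF3 w hw.le s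
            · rw [h]; exact Or.inl rfl
            · rw [h]
              exact (hgP _ ⟨w', by simpa using hw', rfl⟩).1 s'
        obtain ⟨g', h1, h2, h3⟩ := exists_continuousOn_closedCell e F g hF.1
        refine ⟨g', h1, h2, fun x hx hb => ?_⟩
        have hxo := hopen ⟨n, e⟩ x hx hb
        have hκx := huniq ⟨n, e⟩ _ hxo
        have hxne := hne x hxo
        obtain ⟨w, hw, rfl⟩ := hxo
        have hw1 : ‖w‖ < 1 := by simpa using hw
        obtain ⟨hF1, hF2, hF3⟩ := hF.2 w hw1
        simp only [h3 w hw1]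
        exact ⟨hF1, hF2, fun h => absurd h hxne, fun hlt => hF3 (by rwa [hκx] at hlt)⟩)
  refine ⟨⟨fun p => G p.1 p.2, by fun_prop⟩, fun p => (hG p.1).1 p.2, fun x => (hG x).2.1,
    fun s => (hG x₀).2.2.1 rfl s⟩

end CW

/-! ### The unreduced suspension -/

/-- The midpoint of the unit interval. -/
noncomputable def unitMid : I := ⟨1 / 2, by norm_num, by norm_num⟩

@[simp] theorem coe_unitMid : (unitMid : ℝ) = 1 / 2 := rfl

theorem symm_unitMid : unitInterval.symm unitMid = unitMid := by
  ext; simp [unitMid]; norm_num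

section Unreduced

variable {X : Type*} [TopologicalSpace X]

/-- The equivalence relation on `X × I` that collapses each of the two ends. -/
def unreducedSetoid (X : Type*) : Setoid (X × I) where
  r p q := p = q ∨ (p.2 = 0 ∧ q.2 = 0) ∨ (p.2 = 1 ∧ q.2 = 1)
  iseqv :=
    { refl := fun _ => Or.inl rfl
      symm := by
        rintro p q (h | ⟨hp, hq⟩ | ⟨hp, hq⟩)
        · exact Or.inl h.symm
        · exact Or.inr (Or.inl ⟨hq, hp⟩)
        · exact Or.inr (Or.inr ⟨hq, hp⟩)
      trans := by
        rintro p q r (rfl | ⟨hp, hq⟩ | ⟨hp, hq⟩) h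
        · exact h
        · rcases h with rfl | ⟨_, hr⟩ | ⟨h1, _⟩
          · exact Or.inr (Or.inl ⟨hp, hq⟩)
          · exact Or.inr (Or.inl ⟨hp, hr⟩)
          · exact absurd (hq.symm.trans h1) zero_ne_one
        · rcases h with rfl | ⟨h1, _⟩ | ⟨_, hr⟩
          · exact Or.inr (Or.inr ⟨hp, hq⟩)
          · exact absurd (hq.symm.trans h1) one_ne_zero
          · exact Or.inr (Or.inr ⟨hp, hr⟩) }

/-- The unreduced suspension of `X`: each end of the cylinder `X × I` is collapsed to a point, and
the two points, the poles, are kept apart. -/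
def UnreducedSuspension (X : Type*) : Type _ :=
  Quotient (unreducedSetoid X)

instance : TopologicalSpace (UnreducedSuspension X) :=
  inferInstanceAs (TopologicalSpace (Quotient (unreducedSetoid X)))

namespace UnreducedSuspension

/-- The quotient map from the cylinder onto the unreduced suspension. -/
def mk : C(X × I, UnreducedSuspension X) where
  toFun p := Quotient.mk (unreducedSetoid X) p
  continuous_toFun := continuous_quotient_mk'

theorem isQuotientMap_mk : Topology.IsQuotientMap (mk : X × I → UnreducedSuspension X) :=
  isQuotientMap_quotient_mk'

theorem mk_zero (x y : X) : mk (x, 0) = mk (y, 0) :=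
  Quotient.sound (Or.inr (Or.inl ⟨rfl, rfl⟩))

theorem mk_one (x y : X) : mk (x, 1) = mk (y, 1) :=
  Quotient.sound (Or.inr (Or.inr ⟨rfl, rfl⟩))

theorem mk_surjective : Function.Surjective (mk : X × I → UnreducedSuspension X) :=
  Quotient.mk_surjective

theorem mk_eq_iff {p q : X × I} :
    mk p = mk q ↔ p = q ∨ (p.2 = 0 ∧ q.2 = 0) ∨ (p.2 = 1 ∧ q.2 = 1) :=
  Quotient.eq (r := unreducedSetoid X)

/-- A map on the cylinder that is constant on each end descends to the unreduced suspension. -/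
def lift {Z : Type*} [TopologicalSpace Z] (f : C(X × I, Z)) (h0 : ∀ x y, f (x, 0) = f (y, 0))
    (h1 : ∀ x y, f (x, 1) = f (y, 1)) : C(UnreducedSuspension X, Z) where
  toFun := Quotient.lift f (by
    rintro ⟨x, s⟩ ⟨y, t⟩ (h | ⟨h, h'⟩ | ⟨h, h'⟩)
    · rw [h]
    · simp only at h h'; subst h; subst h'; exact h0 x y
    · simp only at h h'; subst h; subst h'; exact h1 x y)
  continuous_toFun := f.continuous.quotient_lift _

@[simp] theorem lift_mk {Z : Type*} [TopologicalSpace Z] (f : C(X × I, Z)) (h0 h1) (p : X × I) :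
    lift f h0 h1 (mk p) = f p := rfl

/-- The height function of the unreduced suspension. -/
def height : C(UnreducedSuspension X, I) :=
  lift ⟨Prod.snd, continuous_snd⟩ (fun _ _ => rfl) (fun _ _ => rfl)

@[simp] theorem height_mk (p : X × I) : height (mk p) = p.2 := rfl

/-- The reflection that exchanges the poles. -/
def flip : C(UnreducedSuspension X, UnreducedSuspension X) :=
  lift (mk.comp ⟨fun p => (p.1, unitInterval.symm p.2), by fun_prop⟩)
    (fun x y => by simpa using mk_one x y) (fun x y => by simpa using mk_zero x y)

@[simp] theorem flip_mk (x : X) (t : I) : flip (mk (x, t)) = mk (x, unitInterval.symm t) := rfl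

@[simp] theorem flip_flip (u : UnreducedSuspension X) : flip (flip u) = u := by
  obtain ⟨⟨x, t⟩, rfl⟩ := mk_surjective u
  simp

@[simp] theorem height_flip (u : UnreducedSuspension X) :
    height (flip u) = unitInterval.symm (height u) := by
  obtain ⟨⟨x, t⟩, rfl⟩ := mk_surjective u
  simp

/-- The projection of the unreduced suspension to `X`. It takes arbitrary values at the poles. -/
noncomputable def proj (u : UnreducedSuspension X) : X :=
  (Quotient.out u).1

theorem mk_proj (u : UnreducedSuspension X) : mk (proj u, height u) = u := by
  have h : mk (Quotient.out u) = u := Quotient.out_eq u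
  conv_rhs => rw [← h]
  have h2 : height u = (Quotient.out u).2 := (congrArg height h).symm
  rw [h2]; rfl

theorem proj_mk (x : X) {t : I} (h0 : t ≠ 0) (h1 : t ≠ 1) : proj (mk (x, t)) = x := by
  rcases mk_eq_iff.1 (mk_proj (mk (x, t))) with h | ⟨-, h⟩ | ⟨-, h⟩
  · exact congrArg Prod.fst h
  · exact absurd h h0
  · exact absurd h h1

theorem continuousOn_proj :
    ContinuousOn (proj : UnreducedSuspension X → X) {u | height u ≠ 0 ∧ height u ≠ 1} := by
  have hO : IsOpen {u : UnreducedSuspension X | height u ≠ 0 ∧ height u ≠ 1} :=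
    (isOpen_ne_fun (by fun_prop) continuous_const).inter
      (isOpen_ne_fun (by fun_prop) continuous_const)
  refine (continuousOn_open_iff hO).2 fun t ht => ?_
  rw [← isQuotientMap_mk.isOpen_preimage]
  have : (mk : X × I → _) ⁻¹' ({u | height u ≠ 0 ∧ height u ≠ 1} ∩ proj ⁻¹' t) =
      (mk : X × I → _) ⁻¹' {u | height u ≠ 0 ∧ height u ≠ 1} ∩ Prod.fst ⁻¹' t := by
    ext ⟨x, s⟩
    refine and_congr_right fun h => ?_
    have hs : proj (mk (x, s)) = x := proj_mk x h.1 h.2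
    change proj (mk (x, s)) ∈ t ↔ x ∈ t
    rw [hs]
  rw [this]
  exact (hO.preimage mk.continuous).inter (ht.preimage continuous_fst)

/-- A homotopy on the cylinder that is constant on each end at each time descends to the unreduced
suspension. -/
theorem exists_homotopy_lift {Z : Type*} [TopologicalSpace Z] (f : C((X × I) × I, Z))
    (h0 : ∀ x y r, f ((x, 0), r) = f ((y, 0), r)) (h1 : ∀ x y r, f ((x, 1), r) = f ((y, 1), r)) :
    ∃ F : C(UnreducedSuspension X × I, Z), ∀ p r, F (mk p, r) = f (p, r) := by
  let F := lift f.curry (fun x y => by ext r; exact h0 x y r) (fun x y => by ext r; exact h1 x y r)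
  exact ⟨⟨fun p => F p.1 p.2, by fun_prop⟩, fun p r => rfl⟩

/-- The part of the suspension below height `2 / 3`, a neighbourhood of the lower cone. -/
def lower (X : Type*) [TopologicalSpace X] : Set (UnreducedSuspension X) :=
  {u | (height u : ℝ) < 2 / 3}

/-- The part of the suspension above height `1 / 3`, a neighbourhood of the upper cone. -/
def upper (X : Type*) [TopologicalSpace X] : Set (UnreducedSuspension X) :=
  {u | 1 / 3 < (height u : ℝ)}

theorem isOpen_lower : IsOpen (lower X) := isOpen_lt (by fun_prop) continuous_const

theorem isOpen_upper : IsOpen (upper X) := isOpen_lt continuous_const (by fun_prop)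

theorem lower_union_upper : lower X ∪ upper X = Set.univ := by
  ext u
  simp only [lower, upper, Set.mem_union, Set.mem_ofPred_eq, Set.mem_univ, iff_true]
  by_contra! h
  linarith

theorem flip_mem_lower {u : UnreducedSuspension X} : flip u ∈ lower X ↔ u ∈ upper X := by
  simp only [lower, upper, Set.mem_ofPred_eq, height_flip, unitInterval.coe_symm_eq]
  constructor <;> intro <;> linarith

/-- A deformation of the suspension along the lines through the poles; at time `1` it is the
identity, and at time `0` it maps `lower X` to the lower pole. -/
theorem exists_lower_contraction (X : Type*) [TopologicalSpace X] :
    ∃ κ : C(UnreducedSuspension X × I, UnreducedSuspension X), (∀ u, κ (u, 1) = u) ∧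
      (∀ u ∈ lower X, height (κ (u, 0)) = 0) ∧ (∀ u r, height (κ (u, r)) ≤ height u) ∧
      (∀ x t r, ∃ t', κ (mk (x, t), r) = mk (x, t')) ∧
      ∃ θ : C(I, I), θ 0 = 0 ∧ θ 1 = unitMid ∧ ∀ x r, κ (mk (x, unitMid), r) = mk (x, θ r) := by
  let ψ : C(I × I, I) := ⟨fun p => p.1 * max p.2 (Set.projIcc 0 1 zero_le_one (3 * (p.1 : ℝ) - 2)),
    continuous_fst.mul (continuous_snd.max (continuous_projIcc.comp (by fun_prop)))⟩
  obtain ⟨κ, hκ⟩ := exists_homotopy_lift (X := X) (mk.comp ⟨fun p : (X × I) × I =>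
    (p.1.1, ψ (p.1.2, p.2)), by fun_prop⟩) (fun x y r => by simpa [ψ] using mk_zero x y)
    (fun x y r => by
      have : ψ (1, r) = 1 := by
        have h : Set.projIcc 0 1 zero_le_one (3 * ((1 : I) : ℝ) - 2) = 1 :=
          Set.projIcc_of_right_le zero_le_one (by norm_num)
        change 1 * max r (Set.projIcc 0 1 zero_le_one (3 * ((1 : I) : ℝ) - 2)) = 1
        rw [h, one_mul]
        exact max_eq_right r.2.2
      change mk (x, ψ (1, r)) = mk (y, ψ (1, r))
      rw [this]
      exact mk_one x y)
  have hκ' : ∀ x t r, κ (mk (x, t), r) = mk (x, ψ (t, r)) := fun x t r => hκ (x, t) r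
  refine ⟨κ, fun u => ?_, fun u hu => ?_, fun u r => ?_, fun x t r => ⟨_, hκ' x t r⟩,
    ⟨fun r => ψ (unitMid, r), by fun_prop⟩, ?_, ?_, fun x r => hκ' x unitMid r⟩
  · obtain ⟨⟨x, t⟩, rfl⟩ := mk_surjective u
    have : max 1 (Set.projIcc 0 1 zero_le_one (3 * (t : ℝ) - 2)) = 1 :=
      max_eq_left (Set.projIcc (0 : ℝ) 1 zero_le_one _).2.2
    rw [hκ']
    simp [ψ, this]
  · obtain ⟨⟨x, t⟩, rfl⟩ := mk_surjective u
    have ht : (t : ℝ) < 2 / 3 := hu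
    rw [hκ', height_mk]
    simp only [ψ, ContinuousMap.coe_mk]
    rw [Set.projIcc_of_le_left zero_le_one (by linarith)]
    exact (congrArg (t * ·) (max_self (0 : I))).trans (mul_zero t)
  · obtain ⟨⟨x, t⟩, rfl⟩ := mk_surjective u
    rw [hκ', height_mk, height_mk]
    exact unitInterval.mul_le_left
  · simp only [ψ, ContinuousMap.coe_mk]
    rw [Set.projIcc_of_le_left zero_le_one (by norm_num)]
    exact (congrArg (unitMid * ·) (max_self (0 : I))).trans (mul_zero _)
  · have : max 1 (Set.projIcc 0 1 zero_le_one (3 * ((unitMid : I) : ℝ) - 2)) = 1 :=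
      max_eq_left (Set.projIcc (0 : ℝ) 1 zero_le_one _).2.2
    simp only [ψ, ContinuousMap.coe_mk, this]
    exact mul_one _

/-- The map from the unreduced to the reduced suspension. -/
def toReduced (x₀ : X) : C(UnreducedSuspension X, ReducedSuspension x₀) :=
  lift (ReducedSuspension.mk x₀)
    (fun _ _ => (ReducedSuspension.mk_eq_base (Or.inl rfl)).trans
      (ReducedSuspension.mk_eq_base (Or.inl rfl)).symm)
    (fun _ _ => (ReducedSuspension.mk_eq_base (Or.inr (Or.inl rfl))).trans
      (ReducedSuspension.mk_eq_base (Or.inr (Or.inl rfl))).symm)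

@[simp] theorem toReduced_mk (x₀ : X) (p : X × I) :
    toReduced x₀ (mk p) = ReducedSuspension.mk x₀ p := rfl

end UnreducedSuspension

/-! ### Comparison of the two suspensions -/

namespace ReducedSuspension

theorem mk_surjective (x₀ : X) : Function.Surjective (mk x₀) := Quotient.mk_surjective

/-- A map on the cylinder that is constant on `X × ∂I ∪ {x₀} × I` descends to the reduced
suspension. -/
def lift {x₀ : X} {Z : Type*} [TopologicalSpace Z] (f : C(X × I, Z)) (z : Z)
    (h : ∀ p ∈ suspensionBase x₀, f p = z) : C(ReducedSuspension x₀, Z) where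
  toFun := Quotient.lift f (by
    rintro p q (h' | ⟨hp, hq⟩)
    · rw [h']
    · rw [h p hp, h q hq])
  continuous_toFun := f.continuous.quotient_lift _

@[simp] theorem lift_mk {x₀ : X} {Z : Type*} [TopologicalSpace Z] (f : C(X × I, Z)) (z : Z) (h)
    (p : X × I) : lift (x₀ := x₀) f z h (mk x₀ p) = f p := rfl

/-- A homotopy on the cylinder that is constant on `X × ∂I ∪ {x₀} × I` descends to the reduced
suspension. -/
theorem exists_homotopy_lift {x₀ : X} {Z : Type*} [TopologicalSpace Z] (f : C((X × I) × I, Z))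
    (z : Z) (h : ∀ p ∈ suspensionBase x₀, ∀ r, f (p, r) = z) :
    ∃ F : C(ReducedSuspension x₀ × I, Z), ∀ p r, F (mk x₀ p, r) = f (p, r) := by
  let F := lift (x₀ := x₀) f.curry (ContinuousMap.const _ z)
    (fun p hp => by ext r; exact h p hp r)
  exact ⟨⟨fun p => F p.1 p.2, by fun_prop⟩, fun p r => rfl⟩

/-- If `x₀` is nondegenerate, there is a map from the reduced to the unreduced suspension that sends
the base point to the midpoint of the line through `x₀`, fixes the midpoints of the lines, and
preserves the two halves. On the line through `x` it first runs from the midpoint of the line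
through `x₀` to the one through `x` by way of the lower pole, and then back by way of the upper
pole. -/
theorem exists_toUnreduced (x₀ : X) (R : C(X × I, X × I))
    (hR : ∀ p, (R p).2 = 0 ∨ (R p).1 = x₀) (hR0 : ∀ x, R (x, 0) = (x, 0))
    (hR1 : ∀ s, R (x₀, s) = (x₀, s)) :
    ∃ ρ : C(ReducedSuspension x₀, UnreducedSuspension X),
      ρ (base x₀) = UnreducedSuspension.mk (x₀, unitMid) ∧
      (∀ x, ρ (mk x₀ (x, unitMid)) = UnreducedSuspension.mk (x, unitMid)) ∧
      (∀ x (t : I), (t : ℝ) ≤ 1 / 2 → (UnreducedSuspension.height (ρ (mk x₀ (x, t))) : ℝ) ≤ 1 / 2) ∧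
      ∀ x (t : I), 1 / 2 ≤ (t : ℝ) →
        1 / 2 ≤ (UnreducedSuspension.height (ρ (mk x₀ (x, t))) : ℝ) := by
  let T : ℝ → ℝ := fun t => max 0 (min (8 * t - 6) (8 - 8 * t)) - max 0 (min (2 - 8 * t) (8 * t))
  have hT : Continuous T := by fun_prop
  let H : X × I → I := fun p => Set.projIcc 0 1 zero_le_one
    (1 / 2 + 1 / 2 * (1 - ((R (p.1, 1)).2 : ℝ)) * T p.2)
  have hH : Continuous H := continuous_projIcc.comp (by fun_prop)
  let A : X × I → X := fun p =>
    (R (p.1, Set.projIcc 0 1 zero_le_one (2 * |2 * (p.2 : ℝ) - 1|))).1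
  have hA : Continuous A := continuous_fst.comp (R.continuous.comp
    (continuous_fst.prodMk (continuous_projIcc.comp (by fun_prop))))
  classical
  let f : X × I → UnreducedSuspension X := fun p =>
    if |2 * (p.2 : ℝ) - 1| ≤ 3 / 4 then UnreducedSuspension.mk (A p, H p)
    else UnreducedSuspension.mk (x₀, H p)
  have hf : Continuous f := by
    refine Continuous.if_le (by fun_prop) (by fun_prop) (by fun_prop) continuous_const
      fun p hp => ?_
    have hA' : A p = (R (p.1, 1)).1 := by
      simp only [A, hp]
      rw [Set.projIcc_of_right_le zero_le_one (by norm_num)]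
      rfl
    rcases hR (p.1, 1) with h | h
    · rcases eq_or_eq_neg_of_abs_eq hp with h' | h'
      · have ht : (p.2 : ℝ) = 7 / 8 := by linarith
        have : H p = 1 := by
          refine Set.projIcc_of_right_le zero_le_one ?_
          simp only [h, T, ht]
          norm_num
        rw [this]
        exact UnreducedSuspension.mk_one _ _
      · have ht : (p.2 : ℝ) = 1 / 8 := by linarith
        have : H p = 0 := by
          refine Set.projIcc_of_le_left zero_le_one ?_
          simp only [h, T, ht]
          norm_num
        rw [this]
        exact UnreducedSuspension.mk_zero _ _
    · rw [hA', h]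
  have hmid : Set.projIcc (0 : ℝ) 1 zero_le_one (1 / 2) = unitMid :=
    Set.projIcc_val zero_le_one unitMid
  have hend : ∀ x (t : I), t = 0 ∨ t = 1 → f (x, t) = UnreducedSuspension.mk (x₀, unitMid) := by
    intro x t ht
    have hTt : T t = 0 := by rcases ht with rfl | rfl <;> norm_num [T]
    have habs : ¬ |2 * (t : ℝ) - 1| ≤ 3 / 4 := by rcases ht with rfl | rfl <;> norm_num
    simp only [f, habs, if_false, H, hTt, mul_zero, add_zero, hmid]
  have hbase : ∀ t : I, f (x₀, t) = UnreducedSuspension.mk (x₀, unitMid) := fun t => by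
    have h1 : A (x₀, t) = x₀ := by simp only [A, hR1]
    have h2 : H (x₀, t) = unitMid := by
      simp only [H, hR1, Set.Icc.coe_one, sub_self, mul_zero, zero_mul, add_zero, hmid]
    simp only [f, h1, h2, ite_self]
  have hheight : ∀ p, UnreducedSuspension.height (f p) = H p := fun p => by
    simp only [f]; split_ifs <;> rfl
  have hval : ∀ p, (UnreducedSuspension.height (f p) : ℝ) =
      max 0 (min 1 (1 / 2 + 1 / 2 * (1 - ((R (p.1, 1)).2 : ℝ)) * T p.2)) := fun p => by
    rw [hheight]; rfl
  have hu : ∀ x, 0 ≤ 1 / 2 * (1 - ((R (x, 1)).2 : ℝ)) := fun x => by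
    have := (R (x, 1)).2.2.2
    linarith
  have hbase' : ∀ p ∈ suspensionBase x₀, f p = UnreducedSuspension.mk (x₀, unitMid) := by
    rintro ⟨x, t⟩ (h | h | h)
    · exact hend x t (Or.inl h)
    · exact hend x t (Or.inr h)
    · simp only at h; subst h; exact hbase t
  refine ⟨lift ⟨f, hf⟩ _ hbase', hbase 0, fun x => ?_, fun x t ht => ?_, fun x t ht => ?_⟩
  · have hT0 : T (1 / 2) = 0 := by norm_num [T]
    have h1 : A (x, unitMid) = x := by
      simp only [A, coe_unitMid]
      norm_num
      rw [hR0]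
    have h2 : H (x, unitMid) = unitMid := by
      simp only [H, coe_unitMid, hT0, mul_zero, add_zero, hmid]
    have h3 : |2 * (unitMid : ℝ) - 1| ≤ 3 / 4 := by norm_num
    change f (x, unitMid) = _
    simp only [f, h1, h2, h3, if_true]
  · change (UnreducedSuspension.height (f (x, t)) : ℝ) ≤ 1 / 2
    rw [hval]
    have hTt : T t ≤ 0 := by
      have : max (0 : ℝ) (min (8 * t - 6) (8 - 8 * t)) = 0 :=
        max_eq_left ((min_le_left _ _).trans (by linarith))
      simp only [T, this]
      have := le_max_left (0 : ℝ) (min (2 - 8 * t) (8 * t))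
      linarith
    have := mul_nonpos_of_nonneg_of_nonpos (hu x) hTt
    exact max_le (by norm_num) ((min_le_right _ _).trans (by linarith))
  · change 1 / 2 ≤ (UnreducedSuspension.height (f (x, t)) : ℝ)
    rw [hval]
    have hTt : 0 ≤ T t := by
      have : max (0 : ℝ) (min (2 - 8 * t) (8 * t)) = 0 :=
        max_eq_left ((min_le_left _ _).trans (by linarith))
      simp only [T, this]
      have := le_max_left (0 : ℝ) (min (8 * t - 6) (8 - 8 * t))
      linarith
    have := mul_nonneg (hu x) hTt
    exact le_max_of_le_right (le_min (by norm_num) (by linarith))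

end ReducedSuspension

end Unreduced

/-! ### Extension of maps from spheres -/

/-- Every map from the unit sphere of `V` to the subset `A` extends to a map from `V` to `A`. -/
def SphereExtension (V : Type*) [NormedAddCommGroup V] {Y : Type*} [TopologicalSpace Y]
    (A : Set Y) : Prop :=
  ∀ g : V → Y, ContinuousOn g (Metric.sphere 0 1) → Set.MapsTo g (Metric.sphere 0 1) A →
    ∃ G : C(V, Y), (∀ v, ‖v‖ = 1 → G v = g v) ∧ ∀ v, G v ∈ A

section SphereExtension

variable {V W : Type*} [NormedAddCommGroup V] [NormedAddCommGroup W]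
  {Y : Type*} [TopologicalSpace Y]

theorem SphereExtension.of_homeomorph {A : Set Y} (h : SphereExtension W A) (e : V ≃ₜ W)
    (he : ∀ v, ‖e v‖ = ‖v‖) : SphereExtension V A := by
  intro g hg hgA
  have he' : ∀ w, ‖e.symm w‖ = ‖w‖ := fun w => by rw [← he, e.apply_symm_apply]
  have hmaps : Set.MapsTo e.symm (Metric.sphere 0 1) (Metric.sphere 0 1) := fun w hw => by
    simpa [he'] using hw
  obtain ⟨G, hG, hGA⟩ := h (g ∘ e.symm) (hg.comp e.symm.continuous.continuousOn hmaps)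
    (hgA.comp hmaps)
  refine ⟨G.comp ⟨e, e.continuous⟩, fun v hv => ?_, fun v => hGA _⟩
  simpa using hG (e v) ((he v).trans hv)

variable [NormedSpace ℝ V]

/-- Extendability of a map from the sphere depends on its homotopy class only. -/
theorem exists_extension_of_homotopy {A : Set Y} (G : V × I → Y)
    (hG : ContinuousOn G (Metric.sphere 0 1 ×ˢ Set.univ)) (hGA : ∀ v s, ‖v‖ = 1 → G (v, s) ∈ A)
    (E : C(V, Y)) (hEA : ∀ v, E v ∈ A) (hE : ∀ v, ‖v‖ = 1 → E v = G (v, 1)) :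
    ∃ F : C(V, Y), (∀ v, ‖v‖ = 1 → F v = G (v, 0)) ∧ ∀ v, F v ∈ A := by
  classical
  let r : V → V × I := fun v => (‖v‖⁻¹ • v, Set.projIcc 0 1 zero_le_one (2 - 2 * ‖v‖))
  have hr1 : ∀ v : V, 1 / 2 ≤ ‖v‖ → ‖(r v).1‖ = 1 := fun v hv => by
    simp only [r, norm_smul, norm_inv, norm_norm]
    exact inv_mul_cancel₀ (by linarith)
  let A₁ : Set V := {v | ‖v‖ ≤ 1 / 2}
  let A₂ : Set V := {v | 1 / 2 ≤ ‖v‖}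
  let F : V → Y := fun v => if v ∈ A₁ then E ((2 : ℝ) • v) else G (r v)
  have h2 : ∀ v ∈ A₂, F v = G (r v) := fun v hv => by
    by_cases h : v ∈ A₁
    · have hn : ‖v‖ = 1 / 2 := le_antisymm h hv
      have : r v = ((2 : ℝ) • v, 1) := by
        simp only [r, hn]
        refine Prod.ext (by norm_num) (Set.projIcc_of_right_le zero_le_one (by norm_num))
      rw [this, ← hE _ (by rw [norm_smul, hn]; norm_num)]
      exact if_pos h
    · exact if_neg h
  have hF : Continuous F := by
    have c1 : ContinuousOn F A₁ :=
      (E.continuous.comp (continuous_const_smul (2 : ℝ))).continuousOn.congr fun v hv => if_pos hv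
    have c2 : ContinuousOn F A₂ := by
      refine ContinuousOn.congr (hG.comp ?_ fun v hv => ⟨by simpa using hr1 v hv, trivial⟩) h2
      refine ContinuousOn.prodMk (ContinuousOn.smul (ContinuousOn.inv₀ (by fun_prop) fun v hv => ?_)
        continuousOn_id) (continuous_projIcc.comp (by fun_prop)).continuousOn
      have : 1 / 2 ≤ ‖v‖ := hv
      linarith
    rw [← continuousOn_univ]
    exact (c1.union_of_isClosed c2 (isClosed_le (by fun_prop) (by fun_prop))
      (isClosed_le (by fun_prop) (by fun_prop))).mono fun v _ => le_total ‖v‖ (1 / 2)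
  refine ⟨⟨F, hF⟩, fun v hv => ?_, fun v => ?_⟩
  · have : r v = (v, 0) := by
      simp only [r, hv]
      refine Prod.ext (by simp) (Set.projIcc_of_le_left zero_le_one (by norm_num))
    change F v = _
    rw [h2 v (by change 1 / 2 ≤ ‖v‖; rw [hv]; norm_num), this]
  · rcases le_total ‖v‖ (1 / 2) with h | h
    · change F v ∈ A
      rw [show F v = _ from if_pos h]
      exact hEA _
    · change F v ∈ A
      rw [h2 v h]
      exact hGA _ _ (hr1 v h)

/-- Maps from spheres to a contractible subset extend. -/
theorem SphereExtension.of_contraction {A : Set Y} (κ : C(Y × I, Y)) (p : Y) (hp : p ∈ A)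
    (h0 : ∀ u ∈ A, κ (u, 0) = p) (h1 : ∀ u ∈ A, κ (u, 1) = u) (hA : ∀ u ∈ A, ∀ r, κ (u, r) ∈ A) :
    SphereExtension V A := by
  intro g hg hgA
  obtain ⟨F, hF, hFA⟩ := exists_extension_of_homotopy (A := A)
    (fun q : V × I => κ (g q.1, unitInterval.symm q.2))
    (κ.continuous.comp_continuousOn ((hg.comp continuousOn_fst fun q hq => hq.1).prodMk
      (by fun_prop))) (fun v s hv => hA _ (hgA (by simpa using hv)) _)
    (ContinuousMap.const _ p) (fun _ => hp)
    (fun v hv => by simp [h0 _ (hgA (show v ∈ Metric.sphere 0 1 by simpa using hv))])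
  refine ⟨F, fun v hv => ?_, hFA⟩
  rw [hF v hv]
  simp [h1 _ (hgA (show v ∈ Metric.sphere 0 1 by simpa using hv))]

end SphereExtension

namespace UnreducedSuspension

variable {X : Type*} [TopologicalSpace X] {V : Type*} [NormedAddCommGroup V]

theorem sphereExtension_lower [NormedSpace ℝ V] [Nonempty X] : SphereExtension V (lower X) := by
  obtain ⟨κ, h1, h0, hle, -⟩ := exists_lower_contraction X
  obtain ⟨x⟩ := ‹Nonempty X›
  refine SphereExtension.of_contraction κ (mk (x, 0)) (by simp [lower]) (fun u hu => ?_)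
    (fun u _ => h1 u) fun u hu r =>
      (lt_of_le_of_lt (show (height _ : ℝ) ≤ height u from hle u r) hu :)
  have := h0 u hu
  obtain ⟨⟨y, t⟩, h⟩ := mk_surjective (κ (u, 0))
  rw [← h] at this ⊢
  simp only [height_mk] at this
  rw [this]
  exact mk_zero _ _

theorem sphereExtension_upper [NormedSpace ℝ V] [Nonempty X] : SphereExtension V (upper X) := by
  intro g hg hgA
  obtain ⟨G, hG, hGA⟩ := sphereExtension_lower (X := X) (flip ∘ g)
    (flip.continuous.comp_continuousOn hg) fun v hv => flip_mem_lower.2 (hgA hv)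
  refine ⟨flip.comp G, fun v hv => by simp [hG v hv], fun v => ?_⟩
  rw [← flip_mem_lower]
  simpa using hGA v

theorem sphereExtension_inter (hX : SphereExtension V (Set.univ : Set X)) :
    SphereExtension V (lower X ∩ upper X) := by
  intro g hg hgA
  have hne : ∀ v, ‖v‖ = 1 → 1 / 3 < (height (g v) : ℝ) ∧ (height (g v) : ℝ) < 2 / 3 :=
    fun v hv => (hgA (show v ∈ Metric.sphere 0 1 by simpa using hv)).symm
  obtain ⟨F, hF, -⟩ := hX (fun v => proj (g v)) (continuousOn_proj.comp hg fun v hv => by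
    have := hne v (by simpa using hv)
    constructor <;> intro h <;> rw [h] at this <;> norm_num at this) fun _ _ => trivial
  have hc : ContinuousOn (fun v => (height (g v) : ℝ)) (Metric.sphere 0 1) :=
    continuous_subtype_val.comp_continuousOn (height.continuous.comp_continuousOn hg)
  obtain ⟨H, hH, hH'⟩ := ContinuousMap.exists_restrict_eq_forall_mem_of_closed
    (⟨_, continuousOn_iff_continuous_domRestrict.1 hc⟩ : C(Metric.sphere (0 : V) 1, ℝ))
    (t := Set.Ioo (1 / 3) (2 / 3)) (fun v => hne v.1 (by simp)) ⟨1 / 2, by norm_num⟩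
    Metric.isClosed_sphere
  refine ⟨mk.comp ⟨fun v =>
    (F v, ⟨H v, by have := hH v; constructor <;> linarith [this.1, this.2]⟩),
    by fun_prop⟩, fun v hv => ?_, fun v => ⟨(hH v).2, (hH v).1⟩⟩
  have h1 : H v = height (g v) := DFunLike.congr_fun hH' ⟨v, by simpa using hv⟩
  have h2 : F v = proj (g v) := hF v hv
  rw [← mk_proj (g v)]
  simp only [ContinuousMap.comp_apply, ContinuousMap.coe_mk, h2, h1]

end UnreducedSuspension

/-- If the `k`-th homotopy groups of `X` vanish, maps from the boundary of the `(k + 1)`-dimensional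
cube to `X` extend. The part of the boundary outside of the bottom face is first pulled together to
its centre, so that the map on the bottom face becomes a generalized loop. -/
theorem sphereExtension_of_subsingleton {X : Type*} [TopologicalSpace X] {k : ℕ}
    (hX : ∀ x : X, Subsingleton (π_ k X x)) :
    SphereExtension ((Fin k → ℝ) × ℝ) (Set.univ : Set X) := by
  intro g hg _
  let p : (Fin k → ℝ) × ℝ := (0, 1)
  let χ : (Fin k → ℝ) × ℝ → ℝ := fun v => max ‖v.1‖ ((v.2 + 1) / 2)
  let u : ((Fin k → ℝ) × ℝ) × I → (Fin k → ℝ) × ℝ := fun q =>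
    (1 - q.2 * χ q.1) • q.1 + ((q.2 : ℝ) * χ q.1) • p
  have hu : Continuous u := by fun_prop
  have hu0 : ∀ v s, ‖v‖ = 1 → u (v, s) ≠ 0 := by
    rintro ⟨w, t⟩ s hv h
    have e1 : (1 - s * χ (w, t)) • w = 0 := by simpa [u, p] using congrArg Prod.fst h
    have e2 : (1 - s * χ (w, t)) * t + s * χ (w, t) = 0 := by
      simpa [u, p] using congrArg Prod.snd h
    rcases smul_eq_zero.1 e1 with h' | h'
    · rw [h'] at e2; linarith
    · subst h'
      have ht : |t| = 1 := by simpa [Prod.norm_def] using hv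
      rcases eq_or_eq_neg_of_abs_eq ht with rfl | rfl
      · linarith
      · have : χ (0, -1) = 0 := by simp [χ]
        rw [this] at e2
        norm_num at e2
  let c : ((Fin k → ℝ) × ℝ) × I → (Fin k → ℝ) × ℝ := fun q => ‖u q‖⁻¹ • u q
  have hc : ContinuousOn c (Metric.sphere 0 1 ×ˢ Set.univ) := fun q hq =>
    (ContinuousAt.smul (hu.norm.continuousAt.inv₀ (norm_ne_zero_iff.2
      (hu0 q.1 q.2 (by simpa using hq.1)))) hu.continuousAt).continuousWithinAt
  have hc1 : ∀ v s, ‖v‖ = 1 → ‖c (v, s)‖ = 1 := fun v s hv => by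
    simp only [c, norm_smul, norm_inv, norm_norm]
    exact inv_mul_cancel₀ (norm_ne_zero_iff.2 (hu0 v s hv))
  have hcp : ∀ v, χ v = 1 → c (v, 1) = p := fun v hv => by
    have : u (v, 1) = p := by simp [u, hv]
    have hp : ‖p‖ = 1 := by simp [p, Prod.norm_def]
    simp [c, this, hp]
  let ℓ : (Fin k → I) → (Fin k → ℝ) × ℝ := fun y => (fun i => 2 * (y i : ℝ) - 1, -1)
  have hℓ : Continuous ℓ := by fun_prop
  have hab : ∀ t : I, |2 * (t : ℝ) - 1| ≤ 1 := fun t => by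
    rw [abs_le]; constructor <;> linarith [t.2.1, t.2.2]
  have hℓ' : ∀ y, ‖(ℓ y).1‖ ≤ 1 := fun y =>
    (pi_norm_le_iff_of_nonneg zero_le_one).2 fun i => hab (y i)
  have hℓ1 : ∀ y, ‖ℓ y‖ = 1 := fun y => by
    rw [Prod.norm_def]
    simpa [ℓ] using hℓ' y
  have hgc : ContinuousOn (fun q => g (c q)) (Metric.sphere 0 1 ×ˢ Set.univ) :=
    hg.comp hc fun q hq => by simpa using hc1 q.1 q.2 (by simpa using hq.1)
  let b : Ω^ (Fin k) X (g p) := ⟨⟨fun y => g (c (ℓ y, 1)), hgc.comp_continuous (by fun_prop)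
    fun y => ⟨by simpa using hℓ1 y, trivial⟩⟩, by
      rintro y ⟨i, hi⟩
      change g (c (ℓ y, 1)) = g p
      rw [hcp]
      have h1 : 1 ≤ ‖(ℓ y).1‖ := by
        refine le_trans (le_of_eq ?_) (norm_le_pi_norm _ i)
        rcases hi with h | h <;> (simp [ℓ, h]; try norm_num)
      simp only [χ]
      rw [le_antisymm (hℓ' y) h1]
      simp [ℓ]⟩
  have hhom : GenLoop.Homotopic b GenLoop.const :=
    Quotient.exact ((hX (g p)).elim (⟦b⟧ : π_ k X (g p)) ⟦GenLoop.const⟧)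
  obtain ⟨H⟩ := hhom
  let y : (Fin k → ℝ) → Fin k → I := fun w i => Set.projIcc 0 1 zero_le_one ((w i + 1) / 2)
  have hy : Continuous y := continuous_pi fun i => continuous_projIcc.comp (by fun_prop)
  let E : C((Fin k → ℝ) × ℝ, X) := ⟨fun v => H (Set.projIcc 0 1 zero_le_one ((v.2 + 1) / 2), y v.1),
    H.continuous.comp ((continuous_projIcc.comp (by fun_prop)).prodMk (by fun_prop))⟩
  obtain ⟨F, hF, -⟩ := exists_extension_of_homotopy (A := Set.univ) (fun q => g (c q)) hgc
    (fun _ _ _ => trivial) E (fun _ => trivial) (by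
      rintro ⟨w, t⟩ hv
      change H (Set.projIcc 0 1 zero_le_one ((t + 1) / 2), y w) = g (c ((w, t), 1))
      have hv' : max ‖w‖ |t| = 1 := by simpa [Prod.norm_def] using hv
      have hw : ‖w‖ ≤ 1 := hv' ▸ le_max_left _ _
      have ht : |t| ≤ 1 := hv' ▸ le_max_right _ _
      by_cases hw1 : ‖w‖ = 1
      · have hi : ∃ i, |w i| = 1 := by
          by_contra! h
          have : ‖w‖ < 1 := (pi_norm_lt_iff zero_lt_one).2 fun i =>
            lt_of_le_of_ne ((norm_le_pi_norm w i).trans hw) (h i)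
          exact this.ne hw1
        obtain ⟨i, hi⟩ := hi
        have hb : y w ∈ Cube.boundary (Fin k) := by
          refine ⟨i, ?_⟩
          rcases eq_or_eq_neg_of_abs_eq hi with h | h
          · exact Or.inr (Set.projIcc_of_right_le zero_le_one (by rw [h]; norm_num))
          · exact Or.inl (Set.projIcc_of_le_left zero_le_one (by rw [h]; norm_num))
        rw [hcp, H.eq_fst _ hb]
        · exact b.2 _ hb
        · simp only [χ, hw1]
          exact max_eq_left (by linarith [(abs_le.1 ht).2])
      · have ht1 : |t| = 1 := by
          rcases max_choice ‖w‖ |t| with h | h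
          · exact absurd (h.symm.trans hv') hw1
          · exact h.symm.trans hv'
        rcases eq_or_eq_neg_of_abs_eq ht1 with rfl | rfl
        · rw [hcp _ (by simp only [χ]; norm_num; exact hw),
            Set.projIcc_of_right_le zero_le_one (by norm_num)]
          exact H.apply_one _
        · rw [Set.projIcc_of_le_left zero_le_one (by norm_num)]
          refine (H.apply_zero _).trans ?_
          change g (c (ℓ (y w), 1)) = _
          have : ℓ (y w) = (w, -1) := by
            refine Prod.ext (funext fun i => ?_) rfl
            have h1 := abs_le.1 ((norm_le_pi_norm w i).trans hw)
            simp only [ℓ, y]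
            rw [Set.projIcc_of_mem zero_le_one ⟨by linarith, by linarith⟩]
            simp only
            ring
          rw [this])
  refine ⟨F, fun v hv => ?_, fun _ => trivial⟩
  rw [hF v hv]
  simp [c, u, hv]

theorem sphereExtension_of_isNConnected {X : Type*} [TopologicalSpace X] {n : ℕ}
    (hX : IsNConnected ((n : ℤ) - 1) X) (ι : Type*) [Fintype ι] (hι : Fintype.card ι ≤ n) :
    SphereExtension (ι → ℝ) (Set.univ : Set X) := by
  rcases hk : Fintype.card ι with _ | k
  · intro g _ _
    have := Fintype.card_eq_zero_iff.1 hk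
    obtain ⟨x⟩ := hX.1
    refine ⟨ContinuousMap.const _ x, fun v hv => ?_, fun _ => trivial⟩
    rw [Subsingleton.elim v 0, norm_zero] at hv
    exact absurd hv zero_ne_one
  · let φ : ι ≃ Fin (k + 1) := Fintype.equivFinOfCardEq hk
    let e : (ι → ℝ) ≃ₜ (Fin k → ℝ) × ℝ :=
      { toFun := fun v => (fun i => v (φ.symm i.castSucc), v (φ.symm (Fin.last k)))
        invFun := fun q i => Fin.snoc (α := fun _ => ℝ) q.1 q.2 (φ i)
        left_inv := fun v => by
          funext i
          obtain ⟨j, rfl⟩ := φ.symm.surjective i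
          simp only [Equiv.apply_symm_apply]
          induction j using Fin.lastCases with
          | last => simp
          | cast j => simp
        right_inv := fun q => by ext <;> simp
        continuous_toFun := by fun_prop
        continuous_invFun := by
          refine continuous_pi fun i => ?_
          obtain ⟨j, rfl⟩ := φ.symm.surjective i
          simp only [Equiv.apply_symm_apply]
          induction j using Fin.lastCases with
          | last => simpa using continuous_snd
          | cast j => simp only [Fin.snoc_castSucc]; fun_prop }
    refine (sphereExtension_of_subsingleton fun x => hX.2 k (by omega) x).of_homeomorph e
      fun v => ?_
    refine le_antisymm ?_ ((pi_norm_le_iff_of_nonneg (norm_nonneg _)).2 fun i => ?_)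
    · rw [Prod.norm_def]
      exact max_le ((pi_norm_le_iff_of_nonneg (norm_nonneg _)).2 fun i => norm_le_pi_norm v _)
        (norm_le_pi_norm v _)
    · obtain ⟨j, rfl⟩ := φ.symm.surjective i
      rw [Prod.norm_def]
      induction j using Fin.lastCases with
      | last => exact le_max_right _ _
      | cast j =>
        exact (norm_le_pi_norm (fun i : Fin k => v (φ.symm i.castSucc)) j).trans (le_max_left _ _)

/-! ### Pushing into a corner of a cube -/

section Push

variable {ι : Type} [Fintype ι]

/-- The number of coordinates of `v` in the open interval `(-1, 1)` whose sign is opposite to that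
of `s`. -/
noncomputable def cornerCount (s : ℝ) (v : ι → ℝ) : ℕ :=
  (Finset.univ.filter fun i => |v i| < 1 ∧ s * v i < 0).card

/-- The expansion of the cube `[-1, 1] ^ ι` from the centre `(-1/2, …, -1/2)` of a corner subcube.
It fixes the boundary, and it carries every point outside of the corner subcube to the boundary,
without making nonnegative coordinates negative. -/
theorem exists_corner_push :
    ∃ h : C(ι → ℝ, ι → ℝ), (∀ v, ‖v‖ = 1 → h v = v) ∧ (∀ v, ‖v‖ ≤ 1 → ‖h v‖ ≤ 1) ∧
      ∀ v, ‖v‖ ≤ 1 → (∀ i, v i < 0) ∨ (‖h v‖ = 1 ∧ ∀ i, h v i < 0 → v i < 0) := by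
  -- The gauge of the cube with respect to the point `(-1/2, …, -1/2)`.
  let e : (ι → ℝ) → ι → ℝ := fun v i => max (-2 * (v i + 1 / 2)) (2 * (v i + 1 / 2) / 3)
  let μ : (ι → ℝ) → ℝ := fun v => ‖e v‖
  let M : (ι → ℝ) → ℝ := fun v => max (μ v) (1 / 3)
  have hμ : Continuous μ := by fun_prop
  have hM0 : ∀ v, 0 < M v := fun v => lt_max_of_lt_right (by norm_num)
  have hM : Continuous M := by fun_prop
  have he0 : ∀ v i, 0 ≤ e v i := fun v i => by
    rcases le_total 0 (v i + 1 / 2) with h | h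
    · exact le_max_of_le_right (by linarith)
    · exact le_max_of_le_left (by linarith)
  have heμ : ∀ v i, e v i ≤ μ v := fun v i => (le_abs_self _).trans (norm_le_pi_norm (e v) i)
  have hb : ∀ v : ι → ℝ, ‖v‖ ≤ 1 → ∀ i, -1 ≤ v i ∧ v i ≤ 1 := fun v hv i =>
    abs_le.1 ((norm_le_pi_norm v i).trans hv)
  have hμ1 : ∀ v, ‖v‖ ≤ 1 → μ v ≤ 1 := fun v hv =>
    (pi_norm_le_iff_of_nonneg zero_le_one).2 fun i => by
      rw [Real.norm_of_nonneg (he0 v i)]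
      have := hb v hv i
      exact max_le (by linarith) (by linarith)
  have hM1 : ∀ v, ‖v‖ ≤ 1 → M v ≤ 1 := fun v hv => max_le (hμ1 v hv) (by norm_num)
  let h : (ι → ℝ) → ι → ℝ := fun v i => -1 / 2 + (v i + 1 / 2) / M v
  have hc : Continuous h := continuous_pi fun i =>
    continuous_const.add (Continuous.div (by fun_prop) hM fun v => (hM0 v).ne')
  have hle : ∀ v, ‖h v‖ ≤ 1 := fun v => (pi_norm_le_iff_of_nonneg zero_le_one).2 fun i => by
    have h1 : e v i ≤ M v := (heμ v i).trans (le_max_left _ _)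
    have h2 : -2 * (v i + 1 / 2) ≤ M v := (le_max_left _ _).trans h1
    have h3 : 2 * (v i + 1 / 2) / 3 ≤ M v := (le_max_right _ _).trans h1
    have h4 : -1 / 2 ≤ (v i + 1 / 2) / M v := by rw [le_div_iff₀ (hM0 v)]; linarith
    have h5 : (v i + 1 / 2) / M v ≤ 3 / 2 := by rw [div_le_iff₀ (hM0 v)]; linarith
    exact abs_le.2 ⟨by simp only [h]; linarith, by simp only [h]; linarith⟩
  refine ⟨⟨h, hc⟩, fun v hv => ?_, fun v _ => hle v, fun v hv => ?_⟩
  · have hMv : M v = 1 := by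
      refine le_antisymm (hM1 v hv.le) (le_max_of_le_left ?_)
      by_contra! hlt
      have : ‖v‖ < 1 := (pi_norm_lt_iff zero_lt_one).2 fun i => by
        have h1 := (heμ v i).trans_lt hlt
        have h2 := (le_max_left _ _).trans_lt h1
        have h3 := (le_max_right _ _).trans_lt h1
        exact abs_lt.2 ⟨by linarith, by linarith⟩
      exact this.ne hv
    funext i
    simp only [h, ContinuousMap.coe_mk, hMv]
    ring
  · by_cases hneg : ∀ i, v i < 0
    · exact Or.inl hneg
    right
    push Not at hneg
    obtain ⟨j, hj⟩ := hneg
    have hMμ : M v = μ v := max_eq_left (by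
      refine le_trans ?_ ((le_max_right _ _).trans (heμ v j))
      linarith)
    have hμ0 : 0 < μ v := hMμ ▸ hM0 v
    refine ⟨le_antisymm (hle v) ?_, fun i hi => ?_⟩
    · by_contra! hlt
      have : ‖e v‖ < μ v := (pi_norm_lt_iff hμ0).2 fun i => by
        have h1 := abs_lt.1 ((norm_le_pi_norm (h v) i).trans_lt hlt)
        have h2 : -1 / 2 < (v i + 1 / 2) / μ v := by
          have := h1.1
          simp only [h, hMμ] at this
          linarith
        have h3 : (v i + 1 / 2) / μ v < 3 / 2 := by
          have := h1.2
          simp only [h, hMμ] at this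
          linarith
        rw [lt_div_iff₀ hμ0] at h2
        rw [div_lt_iff₀ hμ0] at h3
        rw [Real.norm_of_nonneg (he0 v i)]
        exact max_lt (by linarith) (by linarith)
      exact lt_irrefl _ this
    · have h1 : (v i + 1 / 2) / M v < 1 / 2 := by
        have : h v i < 0 := hi
        simp only [h] at this
        linarith
      rw [div_lt_iff₀ (hM0 v)] at h1
      have := hM1 v hv
      linarith

variable {Y : Type*} [TopologicalSpace Y]

/-- A map from the boundary of a cube to `A` extends to the cube in such a way that the points that
are not mapped to `O` have at least `n + 1` coordinates in the half prescribed by `s`. In a cube of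
dimension at most `n` the extension has its values in `A ∩ O`; in higher dimensions it is an
arbitrary extension, composed with the expansion of a corner. -/
theorem exists_extension_cornerCount {A O : Set Y} {n : ℕ} {s : ℝ} (hs : s = 1 ∨ s = -1)
    (hA : SphereExtension (ι → ℝ) A)
    (hAO : Fintype.card ι ≤ n → SphereExtension (ι → ℝ) (A ∩ O)) (g : (ι → ℝ) → Y)
    (hg : ContinuousOn g (Metric.sphere 0 1)) (hgA : ∀ v, ‖v‖ = 1 → g v ∈ A)
    (hgO : ∀ v, ‖v‖ = 1 → g v ∉ O → n + 1 ≤ cornerCount s v) :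
    ∃ G : C(ι → ℝ, Y), (∀ v, ‖v‖ = 1 → G v = g v) ∧ (∀ v, G v ∈ A) ∧
      ∀ v, ‖v‖ < 1 → G v ∉ O → n + 1 ≤ cornerCount s v := by
  by_cases hn : Fintype.card ι ≤ n
  · obtain ⟨G, h1, h2⟩ := hAO hn g hg fun v hv => by
      have hv' : ‖v‖ = 1 := by simpa using hv
      refine ⟨hgA v hv', ?_⟩
      by_contra h
      have h1 := hgO v hv' h
      have h2 : cornerCount s v ≤ Fintype.card ι := Finset.card_le_univ _
      omega
    exact ⟨G, h1, fun v => (h2 v).1, fun v _ h => absurd (h2 v).2 h⟩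
  · obtain ⟨τ, h1, h2⟩ := hA g hg fun v hv => hgA v (by simpa using hv)
    obtain ⟨h, hh1, -, hh3⟩ := exists_corner_push (ι := ι)
    have hss : s * s = 1 := by rcases hs with rfl | rfl <;> norm_num
    have hns : ∀ v : ι → ℝ, ‖s • v‖ = ‖v‖ := fun v => by
      rcases hs with rfl | rfl <;> simp
    refine ⟨τ.comp ⟨fun v => s • h (s • v), by fun_prop⟩, fun v hv => ?_, fun v => h2 _,
      fun v hv hO => ?_⟩
    · simp only [ContinuousMap.comp_apply, ContinuousMap.coe_mk]
      rw [hh1 _ ((hns v).trans hv), smul_smul, hss, one_smul, h1 v hv]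
    · have hvi : ∀ i, |v i| < 1 := fun i => (norm_le_pi_norm v i).trans_lt hv
      rcases hh3 (s • v) ((hns v).trans_le hv.le) with h' | ⟨h', h''⟩
      · have : cornerCount s v = Fintype.card ι := by
          rw [cornerCount, Finset.filter_true_of_mem, Finset.card_univ]
          exact fun i _ => ⟨hvi i, h' i⟩
        omega
      · have hn1 : ‖s • h (s • v)‖ = 1 := (hns _).trans h'
        simp only [ContinuousMap.comp_apply, ContinuousMap.coe_mk, h1 _ hn1] at hO
        refine (hgO _ hn1 hO).trans (Finset.card_le_card fun i hi => ?_)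
        simp only [Finset.mem_filter, Finset.mem_univ, true_and, Pi.smul_apply, smul_eq_mul,
          ← mul_assoc, hss, one_mul] at hi ⊢
        exact ⟨hvi i, by simpa using h'' i hi.2⟩

/-- A homotopy of a map `Φ` that is given on the boundary of the cube extends to the cube within
`A`, with control of the map at time `1` as in `exists_extension_cornerCount`. -/
theorem exists_homotopy_extension_cornerCount {A O : Set Y} {n : ℕ} {s : ℝ} (hs : s = 1 ∨ s = -1)
    (hA : SphereExtension (ι → ℝ) A) (hA' : SphereExtension ((ι → ℝ) × ℝ) A)
    (hAO : Fintype.card ι ≤ n → SphereExtension (ι → ℝ) (A ∩ O)) (Φ : C(ι → ℝ, Y))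
    (hΦ : ∀ v, ‖v‖ ≤ 1 → Φ v ∈ A) (g : (ι → ℝ) → C(I, Y))
    (hg : ContinuousOn g (Metric.sphere 0 1)) (hg0 : ∀ v, ‖v‖ = 1 → g v 0 = Φ v)
    (hgA : ∀ v, ‖v‖ = 1 → ∀ t, g v t ∈ A)
    (hgO : ∀ v, ‖v‖ = 1 → g v 1 ∉ O → n + 1 ≤ cornerCount s v) :
    ∃ G : C(ι → ℝ, C(I, Y)), (∀ v, ‖v‖ = 1 → G v = g v) ∧ (∀ v, ‖v‖ ≤ 1 → G v 0 = Φ v) ∧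
      (∀ v t, G v t ∈ A) ∧ ∀ v, ‖v‖ < 1 → G v 1 ∉ O → n + 1 ≤ cornerCount s v := by
  obtain ⟨τ, hτ1, hτ2, hτ3⟩ := exists_extension_cornerCount hs hA hAO (fun v => g v 1)
    (hg.eval continuousOn_const) (fun v hv => hgA v hv 1) hgO
  classical
  let K : (ι → ℝ) × ℝ → Y := fun q => if q.2 = -1 then Φ q.1 else if q.2 = 1 then τ q.1 else
    g q.1 (Set.projIcc 0 1 zero_le_one ((q.2 + 1) / 2))
  let S₁ : Set ((ι → ℝ) × ℝ) := {q | q.2 = -1}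
  let S₂ : Set ((ι → ℝ) × ℝ) := {q | q.2 = 1}
  let S₃ : Set ((ι → ℝ) × ℝ) := {q | ‖q.1‖ = 1}
  have hK1 : ∀ q ∈ S₁, K q = Φ q.1 := fun q hq => if_pos hq
  have hK2 : ∀ q ∈ S₂, K q = τ q.1 := fun q hq => by
    have h : q.2 = 1 := hq
    have h' : ¬ q.2 = -1 := by rw [h]; norm_num
    exact (if_neg h').trans (if_pos h)
  have hK3 : ∀ q ∈ S₃, K q = g q.1 (Set.projIcc 0 1 zero_le_one ((q.2 + 1) / 2)) := fun q hq => by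
    by_cases h1 : q.2 = -1
    · rw [hK1 q h1, h1, Set.projIcc_of_le_left zero_le_one (by norm_num)]
      exact (hg0 _ hq).symm
    by_cases h2 : q.2 = 1
    · rw [hK2 q h2, h2, Set.projIcc_of_right_le zero_le_one (by norm_num)]
      exact hτ1 _ hq
    · simp only [K, h1, h2, if_false]
  have hcases : ∀ q : (ι → ℝ) × ℝ, ‖q‖ = 1 → q ∈ S₁ ∪ S₂ ∪ S₃ := fun q hq => by
    rw [Prod.norm_def] at hq
    rcases max_choice ‖q.1‖ ‖q.2‖ with h | h
    · exact Or.inr (h.symm.trans hq)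
    · rcases eq_or_eq_neg_of_abs_eq (h.symm.trans hq) with h' | h'
      · exact Or.inl (Or.inr h')
      · exact Or.inl (Or.inl h')
  have hS1 : IsClosed S₁ := isClosed_eq (by fun_prop) (by fun_prop)
  have hS2 : IsClosed S₂ := isClosed_eq (by fun_prop) (by fun_prop)
  have hS3 : IsClosed S₃ := isClosed_eq (by fun_prop) (by fun_prop)
  have hKc : ContinuousOn K (Metric.sphere 0 1) := by
    have c1 : ContinuousOn K S₁ := (Φ.continuous.comp continuous_fst).continuousOn.congr hK1
    have c2 : ContinuousOn K S₂ := (τ.continuous.comp continuous_fst).continuousOn.congr hK2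
    have c3 : ContinuousOn K S₃ := by
      refine ContinuousOn.congr (ContinuousOn.eval (hg.comp continuousOn_fst fun q hq => ?_)
        (continuous_projIcc.comp (by fun_prop)).continuousOn) hK3
      have : ‖q.1‖ = 1 := hq
      simpa using this
    exact ((c1.union_of_isClosed c2 hS1 hS2).union_of_isClosed c3 (hS1.union hS2) hS3).mono
      fun q hq => hcases q (by simpa using hq)
  obtain ⟨F, hF1, hF2⟩ := hA' K hKc fun q hq => by
    have hq1 : ‖q‖ = 1 := by simpa using hq
    rcases hcases q hq1 with (h | h) | h
    · rw [hK1 q h]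
      exact hΦ _ ((norm_fst_le q).trans hq1.le)
    · rw [hK2 q h]
      exact hτ2 _
    · rw [hK3 q h]
      exact hgA _ h _
  let G : C(ι → ℝ, C(I, Y)) := ContinuousMap.curry ⟨fun q : (ι → ℝ) × I => F (q.1, 2 * q.2 - 1),
    by fun_prop⟩
  have hG : ∀ v t, G v t = F (v, 2 * t - 1) := fun v t => rfl
  have hG1 : ∀ v, ‖v‖ ≤ 1 → G v 1 = τ v := fun v hv => by
    have h1 : ((v, 2 * ((1 : I) : ℝ) - 1) : (ι → ℝ) × ℝ) ∈ S₂ := by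
      change 2 * ((1 : I) : ℝ) - 1 = 1
      norm_num
    rw [hG, hF1 _ (by rw [Prod.norm_def]; norm_num; exact hv), hK2 _ h1]
  refine ⟨G, fun v hv => ?_, fun v hv => ?_, fun v t => hF2 _, fun v hv hO => ?_⟩
  · ext t
    have ht : |2 * (t : ℝ) - 1| ≤ 1 := by
      rw [abs_le]; constructor <;> linarith [t.2.1, t.2.2]
    rw [hG, hF1 _ (by rw [Prod.norm_def]; simp only [hv]; exact max_eq_left ht), hK3 _ hv]
    simp only
    rw [show (2 * (t : ℝ) - 1 + 1) / 2 = t by ring, Set.projIcc_val]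
  · have h1 : ((v, 2 * ((0 : I) : ℝ) - 1) : (ι → ℝ) × ℝ) ∈ S₁ := by
      change 2 * ((0 : I) : ℝ) - 1 = -1
      norm_num
    rw [hG, hF1 _ (by rw [Prod.norm_def]; norm_num; exact hv), hK1 _ h1]
  · exact hτ3 v hv (by rwa [hG1 v hv.le] at hO)

end Push

/-! ### The cubical decomposition of Euclidean space -/

section Grid

variable {ι : Type}

/-- The closed cells of the decomposition of `ι → ℝ` into unit cubes with integral vertices. The
`i`-th factor of the cell with index `c` is the point `k` if `c i = 2 * k`, and the interval
`[k, k + 1]` if `c i = 2 * k + 1`. -/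
def gridCube (c : ι → ℤ) : Set (ι → ℝ) :=
  {z | ∀ i, ((c i / 2 : ℤ) : ℝ) ≤ z i ∧ z i ≤ (((c i + 1) / 2 : ℤ) : ℝ)}

/-- The boundary of the cell `gridCube c`. -/
def gridBoundary (c : ι → ℤ) : Set (ι → ℝ) :=
  {z | z ∈ gridCube c ∧ ∃ i, Odd (c i) ∧ (z i = (c i / 2 : ℤ) ∨ z i = ((c i + 1) / 2 : ℤ))}

/-- The index of the cell with `z` in its interior. -/
noncomputable def gridCell (z : ι → ℝ) (i : ι) : ℤ := ⌊z i⌋ + ⌈z i⌉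

theorem gridFactor_even {c : ℤ} (hc : ¬ Odd c) :
    ∃ k : ℤ, c = 2 * k ∧ c / 2 = k ∧ (c + 1) / 2 = k := by
  obtain ⟨k, hk⟩ := Int.not_odd_iff_even.1 hc
  exact ⟨k, by omega, by omega, by omega⟩

theorem gridFactor_odd {c : ℤ} (hc : Odd c) :
    ∃ k : ℤ, c = 2 * k + 1 ∧ c / 2 = k ∧ (c + 1) / 2 = k + 1 := by
  obtain ⟨k, hk⟩ := hc
  exact ⟨k, by omega, by omega, by omega⟩

theorem gridCell_of_lt {z : ι → ℝ} {i : ι} {k : ℤ} (h1 : (k : ℝ) < z i) (h2 : z i < k + 1) :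
    gridCell z i = 2 * k + 1 := by
  have e1 : ⌊z i⌋ = k := Int.floor_eq_iff.2 ⟨h1.le, h2⟩
  have e2 : ⌈z i⌉ = k + 1 := Int.ceil_eq_iff.2 ⟨by push_cast; linarith, by push_cast; linarith⟩
  rw [gridCell, e1, e2]
  ring

theorem gridCell_of_eq {z : ι → ℝ} {i : ι} {k : ℤ} (h : z i = k) : gridCell z i = 2 * k := by
  rw [gridCell, h, Int.floor_intCast, Int.ceil_intCast]
  ring

theorem eq_of_mem_gridCube {c : ι → ℤ} {z : ι → ℝ} (hz : z ∈ gridCube c) {i : ι} {k : ℤ}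
    (h1 : c i / 2 = k) (h2 : (c i + 1) / 2 = k) : z i = k := by
  have := hz i
  rw [h1, h2] at this
  exact le_antisymm this.2 this.1

theorem mem_gridCube_gridCell (z : ι → ℝ) : z ∈ gridCube (gridCell z) := by
  intro i
  by_cases h : z i = ⌊z i⌋
  · rw [gridCell_of_eq h, show 2 * ⌊z i⌋ / 2 = ⌊z i⌋ by omega,
      show (2 * ⌊z i⌋ + 1) / 2 = ⌊z i⌋ by omega]
    exact ⟨h.ge, h.le⟩
  · have h1 := lt_of_le_of_ne (Int.floor_le (z i)) (Ne.symm h)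
    have h2 := Int.lt_floor_add_one (z i)
    rw [gridCell_of_lt h1 h2, show (2 * ⌊z i⌋ + 1) / 2 = ⌊z i⌋ by omega,
      show (2 * ⌊z i⌋ + 1 + 1) / 2 = ⌊z i⌋ + 1 by omega]
    push_cast
    exact ⟨h1.le, h2.le⟩

theorem gridCell_eq {c : ι → ℤ} {z : ι → ℝ} (hz : z ∈ gridCube c) (hb : z ∉ gridBoundary c) :
    gridCell z = c := by
  funext i
  by_cases hc : Odd (c i)
  · obtain ⟨k, hk, h1, h2⟩ := gridFactor_odd hc
    have h3 := hz i
    rw [h1, h2] at h3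
    push_cast at h3
    rw [hk]
    refine gridCell_of_lt (lt_of_le_of_ne h3.1 fun h => hb ⟨hz, i, hc, Or.inl ?_⟩)
      (lt_of_le_of_ne h3.2 fun h => hb ⟨hz, i, hc, Or.inr ?_⟩)
    · rw [h1, h]
    · rw [h2, h]; push_cast; rfl
  · obtain ⟨k, hk, h1, h2⟩ := gridFactor_even hc
    rw [hk]
    exact gridCell_of_eq (eq_of_mem_gridCube hz h1 h2)

/-- The cell of a point is a face of every closed cell that contains the point. -/
theorem gridCube_gridCell_subset {c : ι → ℤ} {z : ι → ℝ} (hz : z ∈ gridCube c) :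
    gridCube (gridCell z) ⊆ gridCube c := by
  intro y hy i
  have hy := hy i
  have hz := hz i
  by_cases h : z i = ⌊z i⌋
  · rw [gridCell_of_eq h, show 2 * ⌊z i⌋ / 2 = ⌊z i⌋ by omega,
      show (2 * ⌊z i⌋ + 1) / 2 = ⌊z i⌋ by omega, ← h] at hy
    exact ⟨hz.1.trans hy.1, hy.2.trans hz.2⟩
  · have h1 := lt_of_le_of_ne (Int.floor_le (z i)) (Ne.symm h)
    have h2 := Int.lt_floor_add_one (z i)
    rw [gridCell_of_lt h1 h2, show (2 * ⌊z i⌋ + 1) / 2 = ⌊z i⌋ by omega,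
      show (2 * ⌊z i⌋ + 1 + 1) / 2 = ⌊z i⌋ + 1 by omega] at hy
    have h3 : c i / 2 ≤ ⌊z i⌋ := Int.le_floor.2 hz.1
    have h4 : ⌊z i⌋ + 1 ≤ (c i + 1) / 2 := by
      have : (⌊z i⌋ : ℝ) < ((c i + 1) / 2 : ℤ) := h1.trans_le hz.2
      exact Int.add_one_le_iff.2 (by exact_mod_cast this)
    exact ⟨(Int.cast_le.2 h3).trans hy.1, hy.2.trans (Int.cast_le.2 h4)⟩

/-- The affine coordinates of the cell `gridCube c`, with range the cube `[-1, 1] ^ d`. -/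
def gridCoord (c : ι → ℤ) : C(ι → ℝ, {i // Odd (c i)} → ℝ) where
  toFun z i := 2 * (z i.1 - (c i.1 / 2 : ℤ)) - 1
  continuous_toFun := by fun_prop

open Classical in
/-- The parametrization of the cell `gridCube c` by the cube `[-1, 1] ^ d`. -/
noncomputable def gridParam (c : ι → ℤ) : C({i // Odd (c i)} → ℝ, ι → ℝ) where
  toFun v i := if h : Odd (c i) then (c i / 2 : ℤ) + (v ⟨i, h⟩ + 1) / 2 else (c i / 2 : ℤ)
  continuous_toFun := continuous_pi fun i => by
    by_cases h : Odd (c i)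
    · simp only [h, dif_pos]; fun_prop
    · simp only [h, dif_neg, not_false_iff]; fun_prop

theorem gridParam_gridCoord {c : ι → ℤ} {z : ι → ℝ} (hz : z ∈ gridCube c) :
    gridParam c (gridCoord c z) = z := by
  funext i
  by_cases h : Odd (c i)
  · simp only [gridParam, gridCoord, ContinuousMap.coe_mk, h, dif_pos]
    ring
  · simp only [gridParam, ContinuousMap.coe_mk, h, dif_neg, not_false_iff]
    obtain ⟨k, hk, h1, h2⟩ := gridFactor_even h
    rw [eq_of_mem_gridCube hz h1 h2, h1]

theorem gridCoord_gridParam (c : ι → ℤ) (v : {i // Odd (c i)} → ℝ) :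
    gridCoord c (gridParam c v) = v := by
  funext i
  simp only [gridParam, gridCoord, ContinuousMap.coe_mk, i.2, dif_pos]
  ring

theorem abs_gridCoord_le {c : ι → ℤ} {z : ι → ℝ} (hz : z ∈ gridCube c) (i : {i // Odd (c i)}) :
    |gridCoord c z i| ≤ 1 := by
  obtain ⟨k, hk, h1, h2⟩ := gridFactor_odd i.2
  have h3 := hz i.1
  rw [h1, h2] at h3
  push_cast at h3
  simp only [gridCoord, ContinuousMap.coe_mk, h1]
  exact abs_le.2 ⟨by linarith, by linarith⟩

theorem isClosed_gridCube (c : ι → ℤ) : IsClosed (gridCube c) := by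
  have : gridCube c =
      Set.univ.pi fun i => Set.Icc ((c i / 2 : ℤ) : ℝ) (((c i + 1) / 2 : ℤ) : ℝ) := by
    ext z; simp only [gridCube, Set.mem_ofPred_eq, Set.mem_univ_pi, Set.mem_Icc]
  rw [this]
  exact isClosed_set_pi fun i _ => isClosed_Icc

variable [Fintype ι]

/-- The dimension of the cell `gridCube c`. -/
def gridDim (c : ι → ℤ) : ℕ := (Finset.univ.filter fun i => Odd (c i)).card

theorem gridDim_gridCell_lt {c : ι → ℤ} {z : ι → ℝ} (hz : z ∈ gridBoundary c) :
    gridDim (gridCell z) < gridDim c := by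
  obtain ⟨hz, j, hj, hzj⟩ := hz
  refine Finset.card_lt_card ⟨fun i hi => ?_, fun hsub => ?_⟩
  · simp only [Finset.mem_filter, Finset.mem_univ, true_and] at hi ⊢
    by_contra hc
    obtain ⟨k, hk, h1, h2⟩ := gridFactor_even hc
    rw [gridCell_of_eq (eq_of_mem_gridCube hz h1 h2)] at hi
    exact Int.not_odd_iff_even.2 (even_two_mul k) hi
  · have : j ∈ Finset.univ.filter fun i => Odd (gridCell z i) := hsub (by simpa using hj)
    simp only [Finset.mem_filter, Finset.mem_univ, true_and] at this
    rcases hzj with h | h <;> rw [gridCell_of_eq h] at this <;>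
      exact Int.not_odd_iff_even.2 (even_two_mul _) this

theorem locallyFinite_gridCube : LocallyFinite (gridCube : (ι → ℤ) → Set (ι → ℝ)) := by
  classical
  intro z
  refine ⟨Metric.ball z 1, Metric.ball_mem_nhds z one_pos, (Set.finite_Icc (fun i => 2 * ⌊z i⌋ - 4)
    (fun i => 2 * ⌊z i⌋ + 6)).subset fun c hc => ?_⟩
  obtain ⟨y, hy, hyz⟩ := hc
  rw [Metric.mem_ball] at hyz
  have key : ∀ i, 2 * ⌊z i⌋ - 4 ≤ c i ∧ c i ≤ 2 * ⌊z i⌋ + 6 := fun i => by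
    have h1 := hy i
    have h2 := abs_lt.1 ((dist_le_pi_dist y z i).trans_lt hyz)
    have h3 := Int.floor_le (z i)
    have h4 := Int.lt_floor_add_one (z i)
    have h5 : c i / 2 < ⌊z i⌋ + 2 := by
      have : ((c i / 2 : ℤ) : ℝ) < ((⌊z i⌋ + 2 : ℤ) : ℝ) := by push_cast; linarith
      exact_mod_cast this
    have h6 : ⌊z i⌋ - 1 < (c i + 1) / 2 := by
      have : ((⌊z i⌋ - 1 : ℤ) : ℝ) < (((c i + 1) / 2 : ℤ) : ℝ) := by push_cast; linarith
      exact_mod_cast this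
    omega
  exact ⟨fun i => (key i).1, fun i => (key i).2⟩

theorem norm_gridCoord_le {c : ι → ℤ} {z : ι → ℝ} (hz : z ∈ gridCube c) : ‖gridCoord c z‖ ≤ 1 :=
  (pi_norm_le_iff_of_nonneg zero_le_one).2 (abs_gridCoord_le hz)

theorem gridParam_mem {c : ι → ℤ} {v : {i // Odd (c i)} → ℝ} (hv : ‖v‖ ≤ 1) :
    gridParam c v ∈ gridCube c := by
  intro i
  by_cases h : Odd (c i)
  · obtain ⟨k, hk, h1, h2⟩ := gridFactor_odd h
    have h3 := abs_le.1 ((norm_le_pi_norm v ⟨i, h⟩).trans hv)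
    simp only [gridParam, ContinuousMap.coe_mk, h, dif_pos, h1, h2]
    push_cast
    constructor <;> linarith
  · obtain ⟨k, hk, h1, h2⟩ := gridFactor_even h
    simp only [gridParam, ContinuousMap.coe_mk, h, dif_neg, not_false_iff, h1, h2, le_refl,
      and_self]

theorem norm_gridCoord_eq_one_iff {c : ι → ℤ} {z : ι → ℝ} (hz : z ∈ gridCube c) :
    ‖gridCoord c z‖ = 1 ↔ z ∈ gridBoundary c := by
  constructor
  · intro h
    have : ∃ i, |gridCoord c z i| = 1 := by
      by_contra! h'
      exact ((pi_norm_lt_iff zero_lt_one).2 fun i =>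
        lt_of_le_of_ne (abs_gridCoord_le hz i) (h' i)).ne h
    obtain ⟨i, hi⟩ := this
    refine ⟨hz, i.1, i.2, ?_⟩
    obtain ⟨k, hk, h1, h2⟩ := gridFactor_odd i.2
    simp only [gridCoord, ContinuousMap.coe_mk] at hi
    rw [h1] at hi
    rw [h1, h2]
    push_cast
    rcases eq_or_eq_neg_of_abs_eq hi with h | h
    · right; linarith
    · left; linarith
  · rintro ⟨-, i, hi, h⟩
    refine le_antisymm (norm_gridCoord_le hz) (le_trans ?_ (norm_le_pi_norm _ ⟨i, hi⟩))
    obtain ⟨k, hk, h1, h2⟩ := gridFactor_odd hi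
    rw [h1, h2] at h
    simp only [gridCoord, ContinuousMap.coe_mk, h1]
    push_cast at h
    rcases h with h | h <;> rw [h] <;> norm_num

/-- The number of non-integral coordinates of `z` that are nearer to the lower end (if `s = 1`) or
to the upper end (if `s = -1`) of the unit interval that contains them. -/
noncomputable def nearCount (s : ℝ) (z : ι → ℝ) : ℕ :=
  (Finset.univ.filter fun i => Int.fract (z i) ≠ 0 ∧ s * (Int.fract (z i) - 1 / 2) < 0).card

theorem nearCount_eq_cornerCount (s : ℝ) {c : ι → ℤ} {z : ι → ℝ} (hz : z ∈ gridCube c) :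
    nearCount s z = cornerCount s (gridCoord c z) := by
  have hodd : ∀ i : {i // Odd (c i)},
      (Int.fract (z i.1) ≠ 0 ∧ s * (Int.fract (z i.1) - 1 / 2) < 0) ↔
      |gridCoord c z i| < 1 ∧ s * gridCoord c z i < 0 := by
    intro i
    obtain ⟨k, hk, h1, h2⟩ := gridFactor_odd i.2
    have h3 := hz i.1
    rw [h1, h2] at h3
    push_cast at h3
    have h4 : gridCoord c z i = 2 * (z i.1 - k) - 1 := by
      simp only [gridCoord, ContinuousMap.coe_mk, h1]
    rw [h4]
    rcases h3.1.eq_or_lt with h | h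
    · rw [← h]; simp
    rcases h3.2.eq_or_lt with h' | h'
    · rw [h', show (k : ℝ) + 1 = ((k + 1 : ℤ) : ℝ) by push_cast; rfl, Int.fract_intCast]
      push_cast
      norm_num
    · have hf : Int.fract (z i.1) = z i.1 - k := by
        rw [Int.fract, Int.floor_eq_iff.2 ⟨h.le, h'⟩]
      rw [hf]
      refine and_congr ⟨fun _ => abs_lt.2 ⟨by linarith, by linarith⟩, fun _ => by linarith⟩ ?_
      rw [show s * (2 * (z i.1 - k) - 1) = 2 * (s * (z i.1 - k - 1 / 2)) by ring]
      constructor <;> intro h <;> linarith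
  symm
  refine Finset.card_bij (fun i _ => i.1) (fun i hi => ?_) (fun i _ j _ h => Subtype.ext h)
    fun i hi => ?_
  · simp only [Finset.mem_filter, Finset.mem_univ, true_and] at hi ⊢
    exact (hodd i).2 hi
  · simp only [Finset.mem_filter, Finset.mem_univ, true_and] at hi
    by_cases h : Odd (c i)
    · exact ⟨⟨i, h⟩, by simpa using (hodd ⟨i, h⟩).1 hi, rfl⟩
    · obtain ⟨k, hk, h1, h2⟩ := gridFactor_even h
      rw [eq_of_mem_gridCube hz h1 h2] at hi
      simp at hi

/-! ### General position -/

variable {Y : Type*} [TopologicalSpace Y]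

theorem exists_gridCube_extension {A O : Set Y} {n : ℕ} {s : ℝ} (hs : s = 1 ∨ s = -1)
    (hA : ∀ (κ : Type) [Fintype κ], SphereExtension (κ → ℝ) A)
    (hA' : ∀ (κ : Type) [Fintype κ], SphereExtension ((κ → ℝ) × ℝ) A)
    (hAO : ∀ (κ : Type) [Fintype κ], Fintype.card κ ≤ n → SphereExtension (κ → ℝ) (A ∩ O))
    (Φ : C(ι → ℝ, Y)) (c : ι → ℤ) (hΦ : Set.MapsTo Φ (gridCube c) A)
    (g : (ι → ℝ) → C(I, Y)) (hg : ContinuousOn g (gridBoundary c))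
    (hg0 : ∀ z ∈ gridBoundary c, g z 0 = Φ z) (hgA : ∀ z ∈ gridBoundary c, ∀ t, g z t ∈ A)
    (hgO : ∀ z ∈ gridBoundary c, g z 1 ∉ O → n + 1 ≤ nearCount s z) :
    ∃ G : (ι → ℝ) → C(I, Y), ContinuousOn G (gridCube c) ∧ Set.EqOn G g (gridBoundary c) ∧
      ∀ z ∈ gridCube c, z ∉ gridBoundary c → G z 0 = Φ z ∧ (∀ t, G z t ∈ A) ∧
        (G z 1 ∉ O → n + 1 ≤ nearCount s z) := by
  have hb : ∀ v : {i // Odd (c i)} → ℝ, ‖v‖ = 1 → gridParam c v ∈ gridBoundary c := fun v hv => by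
    rw [← norm_gridCoord_eq_one_iff (gridParam_mem hv.le), gridCoord_gridParam, hv]
  have hnear : ∀ v : {i // Odd (c i)} → ℝ, ‖v‖ ≤ 1 →
      nearCount s (gridParam c v) = cornerCount s v := fun v hv => by
    rw [nearCount_eq_cornerCount s (gridParam_mem hv), gridCoord_gridParam]
  obtain ⟨G, h1, h2, h3, h4⟩ := exists_homotopy_extension_cornerCount hs (hA {i // Odd (c i)})
    (hA' {i // Odd (c i)}) (hAO {i // Odd (c i)}) (Φ.comp (gridParam c))
    (fun v hv => hΦ (gridParam_mem hv))
    (fun v => g (gridParam c v))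
    (hg.comp (gridParam c).continuous.continuousOn fun v hv => hb v (by simpa using hv))
    (fun v hv => hg0 _ (hb v hv)) (fun v hv => hgA _ (hb v hv))
    (fun v hv hO => hnear v hv.le ▸ hgO _ (hb v hv) hO)
  refine ⟨fun z => G (gridCoord c z), by fun_prop, fun z hz => ?_, fun z hz hzb => ⟨?_, h3 _, ?_⟩⟩
  · simp only
    rw [h1 _ ((norm_gridCoord_eq_one_iff hz.1).2 hz), gridParam_gridCoord hz.1]
  · rw [h2 _ (norm_gridCoord_le hz), ContinuousMap.comp_apply, gridParam_gridCoord hz]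
  · rw [nearCount_eq_cornerCount s hz]
    exact h4 _ (lt_of_le_of_ne (norm_gridCoord_le hz) fun h =>
      hzb ((norm_gridCoord_eq_one_iff hz).1 h))

/-- **General position.** Let every cell of the grid be mapped by `Φ` to `U` or to `V`. Then `Φ` can
be deformed to a map for which the preimage of the complement of `V` consists of points with at
least `n + 1` coordinates near to the lower ends of their intervals, and the preimage of the
complement of `U` of points with at least `n + 1` coordinates near to the upper ends. The
deformation respects the preimages of `U` and `V` cell by cell, and it is stationary on the cells
that are mapped to `U ∩ V`. -/
theorem exists_general_position {U V : Set Y} {n : ℕ}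
    (hU : ∀ (κ : Type) [Fintype κ], SphereExtension (κ → ℝ) U)
    (hU' : ∀ (κ : Type) [Fintype κ], SphereExtension ((κ → ℝ) × ℝ) U)
    (hV : ∀ (κ : Type) [Fintype κ], SphereExtension (κ → ℝ) V)
    (hV' : ∀ (κ : Type) [Fintype κ], SphereExtension ((κ → ℝ) × ℝ) V)
    (hn : ∀ (κ : Type) [Fintype κ], Fintype.card κ ≤ n → SphereExtension (κ → ℝ) (U ∩ V))
    (Φ : C(ι → ℝ, Y))
    (hΦ : ∀ c : ι → ℤ, Set.MapsTo Φ (gridCube c) U ∨ Set.MapsTo Φ (gridCube c) V) :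
    ∃ G : C(ι → ℝ, C(I, Y)), ∀ z, G z 0 = Φ z ∧
      (Set.MapsTo Φ (gridCube (gridCell z)) U → ∀ t, G z t ∈ U) ∧
      (Set.MapsTo Φ (gridCube (gridCell z)) V → ∀ t, G z t ∈ V) ∧
      (Set.MapsTo Φ (gridCube (gridCell z)) (U ∩ V) → ∀ t, G z t = Φ z) ∧
      (G z 1 ∉ V → n + 1 ≤ nearCount 1 z) ∧ (G z 1 ∉ U → n + 1 ≤ nearCount (-1) z) := by
  have : Nonempty C(I, Y) := ⟨ContinuousMap.const _ (Φ 0)⟩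
  refine exists_continuous_of_cells (K := ι → ℝ) (ι := ι → ℤ) (Z := C(I, Y)) gridDim gridCube
    gridBoundary gridCell mem_gridCube_gridCell (fun _ _ => gridCell_eq)
    (fun _ _ => gridDim_gridCell_lt)
    (fun c g hg => ?_)
    (fun g hg => locallyFinite_gridCube.continuous (Set.iUnion_eq_univ_iff.2 fun z =>
      ⟨_, mem_gridCube_gridCell z⟩) isClosed_gridCube hg)
    (fun z ω => ω 0 = Φ z ∧
      (Set.MapsTo Φ (gridCube (gridCell z)) U → ∀ t, ω t ∈ U) ∧
      (Set.MapsTo Φ (gridCube (gridCell z)) V → ∀ t, ω t ∈ V) ∧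
      (Set.MapsTo Φ (gridCube (gridCell z)) (U ∩ V) → ∀ t, ω t = Φ z) ∧
      (ω 1 ∉ V → n + 1 ≤ nearCount 1 z) ∧ (ω 1 ∉ U → n + 1 ≤ nearCount (-1) z))
    (fun c g hgc hgP => ?_)
  · have hlf : LocallyFinite fun c' : {c' : ι → ℤ // gridDim c' < gridDim c} => gridCube c'.1 :=
      locallyFinite_gridCube.comp_injective Subtype.val_injective
    refine (hlf.continuousOn_iUnion (fun c' => isClosed_gridCube _) fun c' => hg c'.1 c'.2).mono
      fun z hz => Set.mem_iUnion.2 ⟨⟨gridCell z, gridDim_gridCell_lt hz⟩, mem_gridCube_gridCell z⟩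
  · have hsub : ∀ z ∈ gridBoundary c, gridCube (gridCell z) ⊆ gridCube c := fun z hz =>
      gridCube_gridCell_subset hz.1
    by_cases h1 : Set.MapsTo Φ (gridCube c) U
    · by_cases h2 : Set.MapsTo Φ (gridCube c) V
      · have h12 : Set.MapsTo Φ (gridCube c) (U ∩ V) := fun z hz => ⟨h1 hz, h2 hz⟩
        refine ⟨fun z => ContinuousMap.const _ (Φ z), by fun_prop, fun z hz => ?_, fun z hz _ => ?_⟩
        · ext t
          exact ((hgP z hz).2.2.2.1 (h12.mono_left (hsub z hz)) t).symm
        · exact ⟨rfl, fun _ _ => h1 hz, fun _ _ => h2 hz, fun _ _ => rfl,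
            fun h => absurd (h2 hz) h, fun h => absurd (h1 hz) h⟩
      · obtain ⟨G, hG1, hG2, hG3⟩ := exists_gridCube_extension (s := 1) (Or.inl rfl)
          hU hU' hn Φ c h1 g
          hgc (fun z hz => (hgP z hz).1) (fun z hz => (hgP z hz).2.1 (h1.mono_left (hsub z hz)))
          (fun z hz => (hgP z hz).2.2.2.2.1)
        refine ⟨G, hG1, hG2, fun z hz hzb => ?_⟩
        obtain ⟨e1, e2, e3⟩ := hG3 z hz hzb
        rw [gridCell_eq hz hzb]
        exact ⟨e1, fun _ => e2, fun h => absurd h h2,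
          fun h => absurd (h.mono_right Set.inter_subset_right) h2, e3, fun h => absurd (e2 1) h⟩
    · have h2 := (hΦ c).resolve_left h1
      obtain ⟨G, hG1, hG2, hG3⟩ := exists_gridCube_extension (A := V) (O := U) (s := -1)
        (Or.inr rfl) hV hV' (fun κ _ hκ => Set.inter_comm U V ▸ hn κ hκ) Φ c h2 g
        hgc (fun z hz => (hgP z hz).1) (fun z hz => (hgP z hz).2.2.1 (h2.mono_left (hsub z hz)))
        (fun z hz => (hgP z hz).2.2.2.2.2)
      refine ⟨G, hG1, hG2, fun z hz hzb => ?_⟩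
      obtain ⟨e1, e2, e3⟩ := hG3 z hz hzb
      rw [gridCell_eq hz hzb]
      exact ⟨e1, fun h => absurd h h1, fun _ => e2,
        fun h => absurd (h.mono_right Set.inter_subset_left) h1, fun h => absurd (e2 1) h, e3⟩

end Grid

/-! ### Deforming families of paths -/

section Families

variable {Y : Type*} [TopologicalSpace Y]

/-- For a map `Φ` regarded as a family of paths from `U` to `V`: the families of paths from `U` to
`V` that agree with `Φ` over the boundary of the parameter cube. -/
def IsPathFamily (U V : Set Y) {m : ℕ} (Φ g : C((Fin m → I) × I, Y)) : Prop :=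
  (∀ y, g (y, 0) ∈ U) ∧ (∀ y, g (y, 1) ∈ V) ∧ ∀ y ∈ Cube.boundary (Fin m), ∀ t, g (y, t) = Φ (y, t)

theorem card_near_le {m : ℕ} (s : ℝ) (z : Fin (m + 1) → ℝ) :
    nearCount s z ≤ (Finset.univ.filter fun i : Fin m => Int.fract (z i.castSucc) ≠ 0 ∧
      s * (Int.fract (z i.castSucc) - 1 / 2) < 0).card + 1 := by
  classical
  refine (Finset.card_le_card (t := insert (Fin.last m) (Finset.image Fin.castSucc
    (Finset.univ.filter fun i : Fin m => Int.fract (z i.castSucc) ≠ 0 ∧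
      s * (Int.fract (z i.castSucc) - 1 / 2) < 0))) fun i hi => ?_).trans
    ((Finset.card_insert_le _ _).trans (Nat.add_le_add_right Finset.card_image_le 1))
  simp only [Finset.mem_filter, Finset.mem_univ, true_and] at hi
  induction i using Fin.lastCases with
  | last => exact Finset.mem_insert_self _ _
  | cast j => exact Finset.mem_insert_of_mem (Finset.mem_image_of_mem _ (by simpa using hi))

/-- A point cannot have `n` coordinates near to the lower ends and `n` coordinates near to the upper
ends of their intervals if there are fewer than `2 * n` coordinates. The two points that are
compared here agree except for the last coordinate. -/
theorem not_nearCount_and_nearCount {m n : ℕ} (hm : m < 2 * n) (z z' : Fin (m + 1) → ℝ)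
    (hz : ∀ i : Fin m, z i.castSucc = z' i.castSucc) (h : n + 1 ≤ nearCount 1 z)
    (h' : n + 1 ≤ nearCount (-1) z') : False := by
  have h1 := h.trans (card_near_le 1 z)
  have h2 := h'.trans (card_near_le (-1) z')
  have hd : Disjoint (Finset.univ.filter fun i : Fin m => Int.fract (z i.castSucc) ≠ 0 ∧
      1 * (Int.fract (z i.castSucc) - 1 / 2) < 0)
      (Finset.univ.filter fun i : Fin m => Int.fract (z' i.castSucc) ≠ 0 ∧
      (-1) * (Int.fract (z' i.castSucc) - 1 / 2) < 0) := by
    refine Finset.disjoint_filter.2 fun i _ hi hi' => ?_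
    rw [hz i] at hi
    linarith [hi.2, hi'.2]
  have h3 := Finset.card_union_of_disjoint hd
  have h4 := Finset.card_le_univ ((Finset.univ.filter fun i : Fin m =>
    Int.fract (z i.castSucc) ≠ 0 ∧ 1 * (Int.fract (z i.castSucc) - 1 / 2) < 0) ∪
      (Finset.univ.filter fun i : Fin m => Int.fract (z' i.castSucc) ≠ 0 ∧
      (-1) * (Int.fract (z' i.castSucc) - 1 / 2) < 0))
  rw [Fintype.card_fin] at h4
  omega

/-- A family of paths from `U` to `V` with fewer than `2 * n` parameters, which lies in `U ∩ V` over
the boundary of the parameter cube, can be deformed in such a way that each path lies in `U` or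
in `V`. -/
theorem exists_separated_family {U V : Set Y} {m n : ℕ} (hm : m < 2 * n) (hUo : IsOpen U)
    (hVo : IsOpen V) (hUV : U ∪ V = Set.univ)
    (hU : ∀ (κ : Type) [Fintype κ], SphereExtension (κ → ℝ) U)
    (hU' : ∀ (κ : Type) [Fintype κ], SphereExtension ((κ → ℝ) × ℝ) U)
    (hV : ∀ (κ : Type) [Fintype κ], SphereExtension (κ → ℝ) V)
    (hV' : ∀ (κ : Type) [Fintype κ], SphereExtension ((κ → ℝ) × ℝ) V)
    (hn : ∀ (κ : Type) [Fintype κ], Fintype.card κ ≤ n → SphereExtension (κ → ℝ) (U ∩ V))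
    (Φ : C((Fin m → I) × I, Y)) (h0 : ∀ y, Φ (y, 0) ∈ U) (h1 : ∀ y, Φ (y, 1) ∈ V)
    (hb : ∀ y ∈ Cube.boundary (Fin m), ∀ t, Φ (y, t) ∈ U ∩ V) :
    ∃ Ψ, ContinuousMap.HomotopicWith Φ Ψ (IsPathFamily U V Φ) ∧
      ∀ y, (∀ t, Ψ (y, t) ∈ U) ∨ ∀ t, Ψ (y, t) ∈ V := by
  -- The cube is subdivided into `M ^ (m + 1)` cubes, each of which is mapped to `U` or to `V`.
  obtain ⟨δ, hδ, hball⟩ := lebesgue_number_lemma_of_metric (s := (Set.univ : Set ((Fin m → I) × I)))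
    (c := fun b : Bool => if b then Φ ⁻¹' U else Φ ⁻¹' V) isCompact_univ
    (by rintro (_ | _); exacts [hVo.preimage Φ.continuous, hUo.preimage Φ.continuous])
    (fun p _ => by
      have : Φ p ∈ U ∪ V := hUV ▸ Set.mem_univ _
      rcases this with h | h
      · exact Set.mem_iUnion.2 ⟨true, h⟩
      · exact Set.mem_iUnion.2 ⟨false, h⟩)
  obtain ⟨M₀, hM₀⟩ := exists_nat_one_div_lt hδ
  let M : ℕ := M₀ + 1
  have hM : (0 : ℝ) < M := by positivity
  have hMδ : 1 / (M : ℝ) < δ := by simpa [M] using hM₀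
  let a : (Fin (m + 1) → ℝ) → (Fin m → I) × I := fun z =>
    (fun i => Set.projIcc 0 1 zero_le_one (z i.castSucc / M),
      Set.projIcc 0 1 zero_le_one (z (Fin.last m) / M))
  have ha : Continuous a := (continuous_pi fun i => continuous_projIcc.comp (by fun_prop)).prodMk
    (continuous_projIcc.comp (by fun_prop))
  let b : C((Fin m → I) × I, Fin (m + 1) → ℝ) :=
    ⟨fun p => Fin.snoc (α := fun _ => ℝ) (fun i => M * (p.1 i : ℝ)) (M * (p.2 : ℝ)), by
      refine continuous_pi fun i => ?_
      induction i using Fin.lastCases with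
      | last => simp only [Fin.snoc_last]; fun_prop
      | cast j => simp only [Fin.snoc_castSucc]; fun_prop⟩
  have hb1 : ∀ p i, b p (Fin.castSucc i) = M * (p.1 i : ℝ) := fun p i => by simp [b]
  have hb2 : ∀ p, b p (Fin.last m) = M * (p.2 : ℝ) := fun p => by simp [b]
  have hab : ∀ p, a (b p) = p := fun p => by
    refine Prod.ext (funext fun i => ?_) ?_
    · simp only [a, hb1]
      rw [mul_div_cancel_left₀ _ hM.ne', Set.projIcc_val]
    · simp only [a, hb2]
      rw [mul_div_cancel_left₀ _ hM.ne', Set.projIcc_val]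
  let Φ' : C(Fin (m + 1) → ℝ, Y) := Φ.comp ⟨a, ha⟩
  have hΦ' : ∀ p, Φ' (b p) = Φ p := fun p => congrArg Φ (hab p)
  obtain ⟨G, hG⟩ := exists_general_position hU hU' hV hV' hn Φ' (fun c => by
    let z₀ : Fin (m + 1) → ℝ := fun i => (c i / 2 : ℤ)
    have hd : ∀ z ∈ gridCube c, a z ∈ Metric.ball (a z₀) δ := fun z hz => by
      have key : ∀ i, dist (Set.projIcc (0 : ℝ) 1 zero_le_one (z i / M))
          (Set.projIcc (0 : ℝ) 1 zero_le_one (z₀ i / M)) ≤ 1 / M := fun i => by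
        refine (Set.abs_projIcc_sub_projIcc zero_le_one).trans ?_
        rw [← sub_div, abs_div, abs_of_pos hM]
        refine div_le_div_of_nonneg_right ?_ hM.le
        have h1 := hz i
        have h2 : (((c i + 1) / 2 : ℤ) : ℝ) ≤ (c i / 2 : ℤ) + 1 := by
          have : (c i + 1) / 2 ≤ c i / 2 + 1 := by omega
          exact_mod_cast this
        exact abs_le.2 ⟨by simp only [z₀]; linarith, by simp only [z₀]; linarith⟩
      rw [Metric.mem_ball, Prod.dist_eq]
      refine (max_le ?_ (key _)).trans_lt hMδ
      exact (dist_pi_le_iff (by positivity)).2 fun i => key _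
    obtain ⟨i, hi⟩ := hball (a z₀) (Set.mem_univ _)
    rcases i with _ | _
    · exact Or.inr fun z hz => hi (hd z hz)
    · exact Or.inl fun z hz => hi (hd z hz))
  -- Integral coordinates are constant on the cell of a point.
  have hint : ∀ z w : Fin (m + 1) → ℝ, w ∈ gridCube (gridCell z) → ∀ i (k : ℤ), z i = k →
      w i = k := fun z w hw i k hk => by
    have h := gridCell_of_eq hk
    exact eq_of_mem_gridCube hw (by rw [h]; omega) (by rw [h]; omega)
  have hzero : ∀ y, Set.MapsTo Φ' (gridCube (gridCell (b (y, 0)))) U := fun y w hw => by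
    have h := hint _ w hw (Fin.last m) 0 (by rw [hb2]; simp)
    have : (a w).2 = 0 := by simp [a, h]
    change Φ (a w) ∈ U
    rw [← Prod.mk.eta (p := a w), this]
    exact h0 _
  have hone : ∀ y, Set.MapsTo Φ' (gridCube (gridCell (b (y, 1)))) V := fun y w hw => by
    have h := hint _ w hw (Fin.last m) M (by rw [hb2]; simp)
    have : (a w).2 = 1 := by simp [a, h, hM.ne']
    change Φ (a w) ∈ V
    rw [← Prod.mk.eta (p := a w), this]
    exact h1 _
  have hbd : ∀ y ∈ Cube.boundary (Fin m), ∀ t,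
      Set.MapsTo Φ' (gridCube (gridCell (b (y, t)))) (U ∩ V) := by
    rintro y ⟨i, hi⟩ t w hw
    have : (a w).1 i = y i := by
      rcases hi with hi | hi
      · have h := hint _ w hw i.castSucc 0 (by rw [hb1]; simp [hi])
        simp [a, h, hi]
      · have h := hint _ w hw i.castSucc M (by rw [hb1]; simp [hi])
        simp [a, h, hi, hM.ne']
    exact hb (a w).1 ⟨i, by rwa [this]⟩ (a w).2
  refine ⟨⟨fun p => G (b p) 1, by fun_prop⟩, ⟨⟨⟨⟨fun q => G (b q.2) q.1, by fun_prop⟩, fun p => ?_,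
    fun p => rfl⟩, fun s => ⟨fun y => ?_, fun y => ?_, fun y hy t => ?_⟩⟩⟩, fun y => ?_⟩
  · exact (hG _).1.trans (hΦ' p)
  · exact (hG _).2.1 (hzero y) s
  · exact (hG _).2.2.1 (hone y) s
  · exact ((hG _).2.2.2.1 (hbd y hy t) s).trans (hΦ' _)
  · by_contra! h
    obtain ⟨⟨t, ht⟩, t', ht'⟩ := h
    exact not_nearCount_and_nearCount hm (b (y, t')) (b (y, t)) (fun i => by rw [hb1, hb1])
      ((hG _).2.2.2.2.1 ht') ((hG _).2.2.2.2.2 ht)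

/-- If each path of a family lies in `U` or in `V`, the family can be contracted to a family of
constant paths in `U ∩ V`: each path is shrunk to one of its points, chosen by a Urysohn function,
which is the starting point if the path leaves `U` and the end point if it leaves `V`. -/
theorem exists_constant_family {U V : Set Y} {m : ℕ} (hUo : IsOpen U) (hVo : IsOpen V)
    (Φ Ψ : C((Fin m → I) × I, Y)) (hΨ : IsPathFamily U V Φ Ψ)
    (hs : ∀ y, (∀ t, Ψ (y, t) ∈ U) ∨ ∀ t, Ψ (y, t) ∈ V)
    (hb : ∀ y ∈ Cube.boundary (Fin m), ∀ t t', Φ (y, t) = Φ (y, t')) :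
    ∃ ζ : C(Fin m → I, Y), (∀ y, ζ y ∈ U ∩ V) ∧
      ContinuousMap.HomotopicWith Ψ (ζ.comp ⟨Prod.fst, continuous_fst⟩) (IsPathFamily U V Φ) := by
  obtain ⟨hΨ0, hΨ1, hΨb⟩ := hΨ
  let A : Set (Fin m → I) := Prod.fst '' (Ψ ⁻¹' Vᶜ)
  let B : Set (Fin m → I) := Prod.fst '' (Ψ ⁻¹' Uᶜ)
  have hA : IsClosed A := isClosedMap_fst_of_compactSpace _
    (hVo.isClosed_compl.preimage Ψ.continuous)
  have hB : IsClosed B := isClosedMap_fst_of_compactSpace _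
    (hUo.isClosed_compl.preimage Ψ.continuous)
  have hA' : ∀ y, y ∉ A → ∀ t, Ψ (y, t) ∈ V := fun y hy t => by
    by_contra h; exact hy ⟨(y, t), h, rfl⟩
  have hB' : ∀ y, y ∉ B → ∀ t, Ψ (y, t) ∈ U := fun y hy t => by
    by_contra h; exact hy ⟨(y, t), h, rfl⟩
  have hBA : Disjoint B A := by
    rw [Set.disjoint_left]
    rintro y ⟨⟨_, t⟩, h, rfl⟩ ⟨⟨_, t'⟩, h', rfl⟩
    rcases hs _ with h1 | h1
    · exact h (h1 t)
    · exact h' (h1 t')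
  obtain ⟨τ, hτB, hτA, hτ⟩ := exists_continuous_zero_one_of_isClosed hB hA hBA
  let η : I × ((Fin m → I) × I) → I := fun q =>
    Set.projIcc 0 1 zero_le_one ((1 - q.1) * q.2.2 + q.1 * τ q.2.1)
  have hη : Continuous η := continuous_projIcc.comp (by fun_prop)
  have hη0 : ∀ p, η (0, p) = p.2 := fun p => by simp [η, Set.projIcc_val]
  have hη1 : ∀ y t, η (1, (y, t)) = ⟨τ y, hτ y⟩ := fun y t => by
    simp only [η, Set.Icc.coe_one, sub_self, zero_mul, one_mul, zero_add]
    exact Set.projIcc_of_mem zero_le_one (hτ y)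
  have hU : ∀ s y, Ψ (y, η (s, (y, 0))) ∈ U := fun s y => by
    by_cases hy : y ∈ B
    · have : η (s, (y, 0)) = 0 := by simp [η, hτB hy]
      rw [this]; exact hΨ0 y
    · exact hB' y hy _
  have hV : ∀ s y, Ψ (y, η (s, (y, 1))) ∈ V := fun s y => by
    by_cases hy : y ∈ A
    · have : η (s, (y, 1)) = 1 := by simp [η, hτA hy]
      rw [this]; exact hΨ1 y
    · exact hA' y hy _
  refine ⟨⟨fun y => Ψ (y, η (1, (y, 0))), by fun_prop⟩, fun y => ⟨hU 1 y, ?_⟩,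
    ⟨⟨⟨⟨fun q => Ψ (q.2.1, η q), by fun_prop⟩, fun p => ?_, fun p => ?_⟩,
      fun s => ⟨hU s, hV s, fun y hy t => (hΨb y hy _).trans (hb y hy _ _)⟩⟩⟩⟩
  · have := hV 1 y
    rwa [hη1, ← hη1 y 0] at this
  · change Ψ (p.1, η (0, p)) = Ψ p
    rw [hη0]
  · change Ψ (p.1, η (1, p)) = Ψ (p.1, η (1, (p.1, 0)))
    rw [show η (1, p) = η (1, (p.1, 0)) from (hη1 p.1 p.2).trans (hη1 p.1 0).symm]

end Families

/-- The main deformation: a family of paths in the unreduced suspension of an `(n - 1)`-connected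
space `X`, with fewer than `2 * n` parameters, that run from the lower to the upper cone and are
constant at midpoints over the boundary of the parameter cube, can be deformed to a family of
constant paths at midpoints. -/
theorem exists_midpoint_family {X : Type*} [TopologicalSpace X] {n m : ℕ}
    (hX : IsNConnected ((n : ℤ) - 1) X) (hm : m < 2 * n)
    (Φ : C((Fin m → I) × I, UnreducedSuspension X))
    (h0 : ∀ y, Φ (y, 0) ∈ UnreducedSuspension.lower X)
    (h1 : ∀ y, Φ (y, 1) ∈ UnreducedSuspension.upper X)
    (f : (Fin m → I) → X) (hf : ∀ y ∈ Cube.boundary (Fin m), ∀ t,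
      Φ (y, t) = UnreducedSuspension.mk (f y, unitMid)) :
    ∃ f' : C(Fin m → I, X), (∀ y ∈ Cube.boundary (Fin m), f' y = f y) ∧
      ContinuousMap.HomotopicWith Φ
        (UnreducedSuspension.mk.comp ⟨fun p => (f' p.1, unitMid), by fun_prop⟩)
        (IsPathFamily (UnreducedSuspension.lower X) (UnreducedSuspension.upper X) Φ) := by
  have := hX.1
  have hmid : ∀ x : X, UnreducedSuspension.mk (x, unitMid) ∈
      UnreducedSuspension.lower X ∩ UnreducedSuspension.upper X := fun x => by
    constructor
    · change ((unitMid : I) : ℝ) < 2 / 3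
      norm_num
    · change 1 / 3 < ((unitMid : I) : ℝ)
      norm_num
  have hmid0 : (unitMid : I) ≠ 0 := fun h => by
    have := congrArg Subtype.val h
    norm_num at this
  have hmid1 : (unitMid : I) ≠ 1 := fun h => by
    have := congrArg Subtype.val h
    norm_num at this
  obtain ⟨Ψ, hΦΨ, hΨ⟩ := exists_separated_family hm UnreducedSuspension.isOpen_lower
    UnreducedSuspension.isOpen_upper UnreducedSuspension.lower_union_upper
    (fun κ _ => UnreducedSuspension.sphereExtension_lower)
    (fun κ _ => UnreducedSuspension.sphereExtension_lower)
    (fun κ _ => UnreducedSuspension.sphereExtension_upper)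
    (fun κ _ => UnreducedSuspension.sphereExtension_upper)
    (fun κ _ hκ => UnreducedSuspension.sphereExtension_inter
      (sphereExtension_of_isNConnected hX κ hκ)) Φ h0 h1
    (fun y hy t => by rw [hf y hy t]; exact hmid _)
  have hfam : IsPathFamily (UnreducedSuspension.lower X) (UnreducedSuspension.upper X) Φ Ψ := by
    obtain ⟨H⟩ := hΦΨ
    have := H.prop' 1
    convert this using 1
    ext p
    exact (H.apply_one p).symm
  obtain ⟨ζ, hζ, hΨζ⟩ := exists_constant_family UnreducedSuspension.isOpen_lower
    UnreducedSuspension.isOpen_upper Φ Ψ hfam hΨ fun y hy t t' => by rw [hf y hy, hf y hy]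
  have hζb : ∀ y ∈ Cube.boundary (Fin m), ζ y = UnreducedSuspension.mk (f y, unitMid) := by
    intro y hy
    obtain ⟨H⟩ := hΨζ
    have h2 := (H.prop' 1).2.2 y hy 0
    rw [hf y hy] at h2
    exact (H.apply_one (y, 0)).symm.trans h2
  have hht : ∀ y, 1 / 3 < (UnreducedSuspension.height (ζ y) : ℝ) ∧
      (UnreducedSuspension.height (ζ y) : ℝ) < 2 / 3 := fun y => (hζ y).symm
  have hproj : Continuous fun y => UnreducedSuspension.proj (ζ y) :=
    UnreducedSuspension.continuousOn_proj.comp_continuous ζ.continuous fun y => by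
      have := hht y
      constructor <;> intro h <;> rw [h] at this <;> norm_num at this
  let f' : C(Fin m → I, X) := ⟨_, hproj⟩
  have hf'b : ∀ y ∈ Cube.boundary (Fin m), f' y = f y := fun y hy => by
    change UnreducedSuspension.proj (ζ y) = f y
    rw [hζb y hy, UnreducedSuspension.proj_mk _ hmid0 hmid1]
  refine ⟨f', hf'b, (hΦΨ.trans hΨζ).trans ?_⟩
  let η : I × (Fin m → I) → I := fun q => Set.projIcc 0 1 zero_le_one
    ((1 - q.1) * (UnreducedSuspension.height (ζ q.2) : ℝ) + q.1 * (1 / 2))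
  have hη : Continuous η := continuous_projIcc.comp (by fun_prop)
  have hηv : ∀ s y, 1 / 3 < (η (s, y) : ℝ) ∧ (η (s, y) : ℝ) < 2 / 3 := fun s y => by
    have h3 := hht y
    have h4 := s.2.1
    have h5 := s.2.2
    have e1 : 1 / 3 < (1 - (s : ℝ)) * (UnreducedSuspension.height (ζ y) : ℝ) + s * (1 / 2) := by
      nlinarith
    have e2 : (1 - (s : ℝ)) * (UnreducedSuspension.height (ζ y) : ℝ) + s * (1 / 2) < 2 / 3 := by
      nlinarith
    simp only [η]
    rw [Set.projIcc_of_mem zero_le_one ⟨by linarith, by linarith⟩]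
    exact ⟨e1, e2⟩
  refine ⟨⟨⟨⟨fun q => UnreducedSuspension.mk (f' q.2.1, η (q.1, q.2.1)), by fun_prop⟩, fun p => ?_,
    fun p => ?_⟩, fun s => ⟨fun y => (hηv s y).2, fun y => (hηv s y).1, fun y hy t => ?_⟩⟩⟩
  · have : η (0, p.1) = UnreducedSuspension.height (ζ p.1) := by simp [η, Set.projIcc_val]
    change UnreducedSuspension.mk (f' p.1, η (0, p.1)) = ζ p.1
    rw [this]
    exact UnreducedSuspension.mk_proj _
  · have : η (1, p.1) = unitMid := by
      simp only [η, Set.Icc.coe_one, sub_self, zero_mul, zero_add, one_mul]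
      exact Set.projIcc_val zero_le_one unitMid
    change UnreducedSuspension.mk (f' p.1, η (1, p.1)) = UnreducedSuspension.mk (f' p.1, unitMid)
    rw [this]
  · have : η (s, y) = unitMid := by
      have h2 : UnreducedSuspension.height (ζ y) = unitMid := by rw [hζb y hy]; rfl
      simp only [η, h2, coe_unitMid]
      rw [show (1 - (s : ℝ)) * (1 / 2) + s * (1 / 2) = ((unitMid : I) : ℝ) by
        rw [coe_unitMid]; ring]
      exact Set.projIcc_val zero_le_one unitMid
    change UnreducedSuspension.mk (f' y, η (s, y)) = Φ (y, t)
    rw [this, hf y hy, hf'b y hy]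

/-! ### From families of paths to loops in the reduced suspension -/

/-- The coordinate of the middle third of the unit interval, constant on the other two thirds. -/
noncomputable def middleThird : C(I, I) :=
  ⟨fun t => Set.projIcc 0 1 zero_le_one (3 * (t : ℝ) - 1), continuous_projIcc.comp (by fun_prop)⟩

theorem middleThird_of_le {t : I} (h : (t : ℝ) ≤ 1 / 3) : middleThird t = 0 :=
  Set.projIcc_of_le_left zero_le_one (by linarith)

theorem middleThird_of_ge {t : I} (h : 2 / 3 ≤ (t : ℝ)) : middleThird t = 1 :=
  Set.projIcc_of_right_le zero_le_one (by linarith)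

@[simp] theorem middleThird_zero : middleThird 0 = 0 := middleThird_of_le (by norm_num)

@[simp] theorem middleThird_one : middleThird 1 = 1 := middleThird_of_ge (by norm_num)

/-- The affine homotopy between two parameters in the unit interval. -/
noncomputable def unitLine : C((I × I) × I, I) :=
  ⟨fun q => Set.projIcc 0 1 zero_le_one ((1 - (q.2 : ℝ)) * q.1.1 + q.2 * q.1.2),
    continuous_projIcc.comp (by fun_prop)⟩

@[simp] theorem unitLine_zero (p : I × I) : unitLine (p, 0) = p.1 := by
  simp [unitLine, Set.projIcc_val]

@[simp] theorem unitLine_one (p : I × I) : unitLine (p, 1) = p.2 := by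
  simp [unitLine, Set.projIcc_val]

@[simp] theorem unitLine_self (t s : I) : unitLine ((t, t), s) = t := by
  simp only [unitLine, ContinuousMap.coe_mk]
  rw [show (1 - (s : ℝ)) * t + s * t = t by ring]
  exact Set.projIcc_val _ t

theorem coe_unitLine (p : I × I) (s : I) :
    (unitLine (p, s) : ℝ) = (1 - (s : ℝ)) * p.1 + s * p.2 := by
  have h1 := s.2.1
  have h2 := s.2.2
  have h3 := p.1.2.1
  have h4 := p.1.2.2
  have h5 := p.2.2.1
  have h6 := p.2.2.2
  have : (1 - (s : ℝ)) * p.1 + s * p.2 ∈ Set.Icc (0 : ℝ) 1 := ⟨by nlinarith, by nlinarith⟩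
  simp only [unitLine, ContinuousMap.coe_mk, Set.projIcc_of_mem zero_le_one this]

theorem unitLine_mid_le {t s : I} (h : (t : ℝ) ≤ 1 / 2) :
    (unitLine ((unitMid, t), s) : ℝ) ≤ 1 / 2 := by
  rw [coe_unitLine, coe_unitMid]
  nlinarith [s.2.1]

theorem le_unitLine_mid {t s : I} (h : 1 / 2 ≤ (t : ℝ)) :
    1 / 2 ≤ (unitLine ((unitMid, t), s) : ℝ) := by
  rw [coe_unitLine, coe_unitMid]
  nlinarith [s.2.1]

/-- The map that appends a last coordinate to a point of a cube. -/
def cubeSnoc {k : ℕ} : C((Fin k → I) × I, Fin (k + 1) → I) :=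
  ⟨fun p => Fin.snoc (α := fun _ => I) p.1 p.2, by
    refine continuous_pi fun i => ?_
    induction i using Fin.lastCases with
    | last => simpa using continuous_snd
    | cast j => simp only [Fin.snoc_castSucc]; fun_prop⟩

@[simp] theorem cubeSnoc_last {k : ℕ} (p : (Fin k → I) × I) : cubeSnoc p (Fin.last k) = p.2 := by
  simp [cubeSnoc]

@[simp] theorem cubeSnoc_castSucc {k : ℕ} (p : (Fin k → I) × I) (i : Fin k) :
    cubeSnoc p i.castSucc = p.1 i := by
  simp [cubeSnoc]

theorem cubeSnoc_eta {k : ℕ} (y : Fin (k + 1) → I) :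
    cubeSnoc (fun i => y i.castSucc, y (Fin.last k)) = y := by
  funext i
  induction i using Fin.lastCases <;> simp

theorem mem_boundary_succ {k : ℕ} {y : Fin (k + 1) → I} : y ∈ Cube.boundary (Fin (k + 1)) ↔
    (y (Fin.last k) = 0 ∨ y (Fin.last k) = 1) ∨
      (fun i => y i.castSucc) ∈ Cube.boundary (Fin k) := by
  constructor
  · rintro ⟨i, hi⟩
    induction i using Fin.lastCases with
    | last => exact Or.inl hi
    | cast j => exact Or.inr ⟨j, hi⟩
  · rintro (h | ⟨j, h⟩)
    · exact ⟨_, h⟩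
    · exact ⟨_, h⟩

namespace GenLoop

variable {N W Z : Type*} [TopologicalSpace W] [TopologicalSpace Z] {w : W} {z : Z}

theorem homotopic_of_family {f g : Ω^ N W w} (H : C(I × (N → I), W)) (h0 : ∀ y, H (0, y) = f y)
    (h1 : ∀ y, H (1, y) = g y) (hb : ∀ s, ∀ y ∈ Cube.boundary N, H (s, y) = w) : Homotopic f g :=
  ⟨⟨⟨H, h0, h1⟩, fun s y hy => (hb s y hy).trans (f.2 y hy).symm⟩⟩

/-- The composition of a generalized loop with a based map. -/
def postcomp (h : C(W, Z)) (hw : h w = z) (g : Ω^ N W w) : Ω^ N Z z :=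
  ⟨h.comp g.1, fun y hy => (congrArg h (g.2 y hy)).trans hw⟩

theorem postcomp_apply (h : C(W, Z)) (hw : h w = z) (g : Ω^ N W w) (y : N → I) :
    postcomp h hw g y = h (g y) := rfl

theorem homotopic_postcomp (F : C(W × I, Z)) (hF : ∀ s, F (w, s) = z) (h h' : C(W, Z)) (hw hw')
    (h0 : ∀ x, F (x, 0) = h x) (h1 : ∀ x, F (x, 1) = h' x) (g : Ω^ N W w) :
    Homotopic (postcomp (z := z) h hw g) (postcomp h' hw' g) :=
  homotopic_of_family ⟨fun q => F (g q.2, q.1), F.continuous.comp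
      ((g.1.continuous.comp continuous_snd).prodMk continuous_fst)⟩
    (fun y => h0 _) (fun y => h1 _) fun s y hy => by
      change F (g y, s) = z
      rw [GenLoop.boundary g y hy, hF]

/-- The reparametrization of the last coordinate of a generalized loop. -/
def reparamLast {k : ℕ} (θ : C(I, I)) (h0 : θ 0 = 0) (h1 : θ 1 = 1) (g : Ω^ (Fin (k + 1)) W w) :
    Ω^ (Fin (k + 1)) W w :=
  ⟨⟨fun y => g (cubeSnoc (fun i => y i.castSucc, θ (y (Fin.last k)))),
    g.1.continuous.comp (by fun_prop)⟩, fun y hy => by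
      refine GenLoop.boundary g _ (mem_boundary_succ.2 ?_)
      simp only [cubeSnoc_last, cubeSnoc_castSucc]
      rcases mem_boundary_succ.1 hy with (h | h) | h
      · rw [h, h0]; exact Or.inl (Or.inl rfl)
      · rw [h, h1]; exact Or.inl (Or.inr rfl)
      · exact Or.inr h⟩

theorem reparamLast_apply {k : ℕ} (θ : C(I, I)) (h0 : θ 0 = 0) (h1 : θ 1 = 1)
    (g : Ω^ (Fin (k + 1)) W w) (y : Fin (k + 1) → I) : reparamLast θ h0 h1 g y =
      g (cubeSnoc (fun i => y i.castSucc, θ (y (Fin.last k)))) := rfl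

theorem homotopic_reparamLast {k : ℕ} (θ : C(I, I)) (h0 : θ 0 = 0) (h1 : θ 1 = 1)
    (g : Ω^ (Fin (k + 1)) W w) : Homotopic g (reparamLast θ h0 h1 g) := by
  refine homotopic_of_family ⟨fun q => g (cubeSnoc (fun i => q.2 i.castSucc,
    unitLine ((q.2 (Fin.last k), θ (q.2 (Fin.last k))), q.1))), g.1.continuous.comp (by fun_prop)⟩
    (fun y => ?_) (fun y => ?_) (fun s y hy => ?_)
  · simp only [ContinuousMap.coe_mk, unitLine_zero, cubeSnoc_eta]
  · simp only [ContinuousMap.coe_mk, unitLine_one, reparamLast_apply]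
  · refine GenLoop.boundary g _ (mem_boundary_succ.2 ?_)
    simp only [cubeSnoc_last, cubeSnoc_castSucc]
    rcases mem_boundary_succ.1 hy with (h | h) | h
    · rw [h, h0, unitLine_self]; exact Or.inl (Or.inl rfl)
    · rw [h, h1, unitLine_self]; exact Or.inl (Or.inr rfl)
    · exact Or.inr h

end GenLoop

section Cap

variable {X : Type*} [TopologicalSpace X]

/-- The closing map for paths that run from the lower to the upper cone: on the middle third of the
unit interval it is the projection to the reduced suspension, and on the outer thirds it contracts
the end points of the paths to the poles, and so to the base point. -/
theorem exists_cap (x₀ : X) :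
    ∃ C : C(UnreducedSuspension X × I, ReducedSuspension x₀),
      (∀ u ∈ UnreducedSuspension.lower X, C (u, 0) = ReducedSuspension.base x₀) ∧
      (∀ u ∈ UnreducedSuspension.upper X, C (u, 1) = ReducedSuspension.base x₀) ∧
      (∀ u (t : I), 1 / 3 ≤ (t : ℝ) → (t : ℝ) ≤ 2 / 3 →
        C (u, t) = UnreducedSuspension.toReduced x₀ u) ∧
      (∀ s t, C (UnreducedSuspension.mk (x₀, s), t) = ReducedSuspension.base x₀) ∧
      ∃ θ : C(I, I), θ 0 = 0 ∧ θ 1 = 1 ∧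
        ∀ x t, C (UnreducedSuspension.mk (x, unitMid), t) = ReducedSuspension.mk x₀ (x, θ t) := by
  obtain ⟨κ, hκ1, hκ0, -, hκl, θ₀, hθ0, hθ1, hκθ⟩ := UnreducedSuspension.exists_lower_contraction X
  let α : C(I, I) := ⟨fun t => Set.projIcc 0 1 zero_le_one (3 * (t : ℝ)),
    continuous_projIcc.comp (by fun_prop)⟩
  let β : C(I, I) := ⟨fun t => Set.projIcc 0 1 zero_le_one (3 - 3 * (t : ℝ)),
    continuous_projIcc.comp (by fun_prop)⟩
  have hα1 : ∀ t : I, 1 / 3 ≤ (t : ℝ) → α t = 1 := fun t ht =>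
    Set.projIcc_of_right_le zero_le_one (by linarith)
  have hβ1 : ∀ t : I, (t : ℝ) ≤ 2 / 3 → β t = 1 := fun t ht =>
    Set.projIcc_of_right_le zero_le_one (by linarith)
  have hα0 : α 0 = 0 := Set.projIcc_of_le_left zero_le_one (by norm_num)
  have hβ0 : β 1 = 0 := Set.projIcc_of_le_left zero_le_one (by norm_num)
  let m : UnreducedSuspension X × I → UnreducedSuspension X := fun q =>
    UnreducedSuspension.flip (κ (UnreducedSuspension.flip (κ (q.1, α q.2)), β q.2))
  have hm : Continuous m := by fun_prop
  have hend : ∀ u : UnreducedSuspension X, UnreducedSuspension.height u = 0 ∨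
      UnreducedSuspension.height u = 1 →
      UnreducedSuspension.toReduced x₀ u = ReducedSuspension.base x₀ := by
    intro u hu
    obtain ⟨p, rfl⟩ := UnreducedSuspension.mk_surjective u
    exact ReducedSuspension.mk_eq_base (hu.imp id Or.inl)
  have hmβ : ∀ u (t : I), (t : ℝ) ≤ 2 / 3 → m (u, t) = κ (u, α t) := fun u t ht => by
    simp only [m, hβ1 t ht, hκ1, UnreducedSuspension.flip_flip]
  have hmα : ∀ u (t : I), 1 / 3 ≤ (t : ℝ) →
      m (u, t) = UnreducedSuspension.flip (κ (UnreducedSuspension.flip u, β t)) := fun u t ht => by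
    simp only [m, hα1 t ht, hκ1]
  have hθc : Continuous fun t : I => if (t : ℝ) ≤ 1 / 2 then θ₀ (α t) else
      unitInterval.symm (θ₀ (β t)) := by
    refine Continuous.if_le (by fun_prop) (by fun_prop) (by fun_prop) continuous_const
      fun t ht => ?_
    rw [hα1 t (by linarith), hβ1 t (by linarith), hθ1, symm_unitMid]
  refine ⟨⟨fun q => UnreducedSuspension.toReduced x₀ (m q), by fun_prop⟩, fun u hu => ?_,
    fun u hu => ?_, fun u t h1 h2 => ?_, fun s t => ?_, ⟨_, hθc⟩, ?_, ?_, fun x t => ?_⟩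
  · refine hend _ (Or.inl ?_)
    rw [hmβ u 0 (by norm_num), hα0]
    exact hκ0 u hu
  · refine hend _ (Or.inr ?_)
    have : UnreducedSuspension.flip u ∈ UnreducedSuspension.lower X :=
      UnreducedSuspension.flip_mem_lower.2 hu
    rw [hmα u 1 (by norm_num), hβ0, UnreducedSuspension.height_flip, hκ0 _ this,
      unitInterval.symm_zero]
  · change UnreducedSuspension.toReduced x₀ (m (u, t)) = _
    rw [hmβ u t h2, hα1 t h1, hκ1]
  · obtain ⟨t₁, h1⟩ := hκl x₀ s (α t)
    obtain ⟨t₂, h2⟩ := hκl x₀ (unitInterval.symm t₁) (β t)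
    change UnreducedSuspension.toReduced x₀ (UnreducedSuspension.flip
      (κ (UnreducedSuspension.flip (κ (UnreducedSuspension.mk (x₀, s), α t)), β t))) = _
    rw [h1, UnreducedSuspension.flip_mk, h2, UnreducedSuspension.flip_mk]
    exact ReducedSuspension.mk_eq_base (Or.inr (Or.inr rfl))
  · have : ((0 : I) : ℝ) ≤ 1 / 2 := by norm_num
    simp only [ContinuousMap.coe_mk, this, if_true, hα0, hθ0]
  · have : ¬ ((1 : I) : ℝ) ≤ 1 / 2 := by norm_num
    simp only [ContinuousMap.coe_mk, this, if_false, hβ0, hθ0, unitInterval.symm_zero]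
  · change UnreducedSuspension.toReduced x₀ (m (UnreducedSuspension.mk (x, unitMid), t)) = _
    by_cases ht : (t : ℝ) ≤ 1 / 2
    · rw [hmβ _ t (by linarith), hκθ]
      simp only [ContinuousMap.coe_mk, ht, if_true, UnreducedSuspension.toReduced_mk]
    · rw [hmα _ t (by linarith), UnreducedSuspension.flip_mk, symm_unitMid, hκθ]
      simp only [ContinuousMap.coe_mk, ht, if_false, UnreducedSuspension.flip_mk,
        UnreducedSuspension.toReduced_mk]

end Cap

/-! ### The suspension theorem -/

section Freudenthal

variable {X : Type*} [TopologicalSpace X] {x₀ : X} {n k : ℕ}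

/-- A map from the reduced to the unreduced suspension is a comparison map if it sends the base
point to the midpoint over `x₀`, fixes the points of height `1 / 2`, and preserves the two halves of
the suspension. -/
structure IsComparison (ρ : C(ReducedSuspension x₀, UnreducedSuspension X)) : Prop where
  base : ρ (ReducedSuspension.base x₀) = UnreducedSuspension.mk (x₀, unitMid)
  mid : ∀ x, ρ (ReducedSuspension.mk x₀ (x, unitMid)) = UnreducedSuspension.mk (x, unitMid)
  le : ∀ x (t : I), (t : ℝ) ≤ 1 / 2 →
    (UnreducedSuspension.height (ρ (ReducedSuspension.mk x₀ (x, t))) : ℝ) ≤ 1 / 2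
  ge : ∀ x (t : I), 1 / 2 ≤ (t : ℝ) →
    1 / 2 ≤ (UnreducedSuspension.height (ρ (ReducedSuspension.mk x₀ (x, t))) : ℝ)

namespace IsComparison

variable {ρ : C(ReducedSuspension x₀, UnreducedSuspension X)} (hρ : IsComparison ρ)
include hρ

theorem mem_lower (x : X) {t : I} (ht : (t : ℝ) ≤ 1 / 2) :
    ρ (ReducedSuspension.mk x₀ (x, t)) ∈ UnreducedSuspension.lower X :=
  (hρ.le x t ht).trans_lt (by norm_num)

theorem mem_upper (x : X) {t : I} (ht : 1 / 2 ≤ (t : ℝ)) :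
    ρ (ReducedSuspension.mk x₀ (x, t)) ∈ UnreducedSuspension.upper X :=
  lt_of_lt_of_le (by norm_num) (hρ.ge x t ht)

theorem base_mem_lower : ρ (ReducedSuspension.base x₀) ∈ UnreducedSuspension.lower X :=
  hρ.mem_lower x₀ (t := 0) (by norm_num)

theorem base_mem_upper : ρ (ReducedSuspension.base x₀) ∈ UnreducedSuspension.upper X := by
  rw [← ReducedSuspension.mk_eq_base (p := (x₀, 1)) (Or.inr (Or.inr rfl))]
  exact hρ.mem_upper x₀ (t := 1) (by norm_num)

/-- The comparison map, followed by the projection to the reduced suspension, is homotopic to the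
identity. The homotopies are: a reparametrization of the lines, the growth of the paths
`t ↦ ρ (x ∧ t)` from their midpoints with the outer thirds of the parameter interval filled by the
closing map, and a second reparametrization. -/
theorem homotopic_toReduced
    (g : Ω^ (Fin (k + 1)) (ReducedSuspension x₀) (ReducedSuspension.base x₀))
    (hb : (UnreducedSuspension.toReduced x₀).comp ρ (ReducedSuspension.base x₀) =
      ReducedSuspension.base x₀) :
    GenLoop.Homotopic g (GenLoop.postcomp ((UnreducedSuspension.toReduced x₀).comp ρ) hb g) := by
  obtain ⟨C, hC0, hC1, hCm, hCb, θ, hθ0, hθ1, hCθ⟩ := exists_cap x₀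
  have hbase : ∀ p ∈ suspensionBase x₀, ReducedSuspension.mk x₀ p = ReducedSuspension.base x₀ :=
    fun p hp => ReducedSuspension.mk_eq_base hp
  -- Reparametrizations of the lines of the suspension.
  have hline : ∀ φ : C(I, I), φ 0 = 0 → φ 1 = 1 →
      ∃ F : C(ReducedSuspension x₀ × I, ReducedSuspension x₀), ∀ p s,
        F (ReducedSuspension.mk x₀ p, s) =
          ReducedSuspension.mk x₀ (p.1, unitLine ((p.2, φ p.2), s)) := fun φ h0 h1 => by
    refine ReducedSuspension.exists_homotopy_lift ⟨fun q : (X × I) × I => ReducedSuspension.mk x₀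
      (q.1.1, unitLine ((q.1.2, φ q.1.2), q.2)), by fun_prop⟩ (ReducedSuspension.base x₀) ?_
    rintro ⟨x, t⟩ ht s
    refine ReducedSuspension.mk_eq_base ?_
    rcases ht with h | h | h
    · simp only at h
      subst h
      exact Or.inl (by simp only [h0, unitLine_self])
    · simp only at h
      subst h
      exact Or.inr (Or.inl (by simp only [h1, unitLine_self]))
    · exact Or.inr (Or.inr h)
  obtain ⟨F₁, hF₁⟩ := hline θ hθ0 hθ1
  obtain ⟨F₃, hF₃⟩ := hline middleThird middleThird_zero middleThird_one
  obtain ⟨F₂, hF₂⟩ := ReducedSuspension.exists_homotopy_lift (x₀ := x₀)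
    ⟨fun q : (X × I) × I => C (ρ (ReducedSuspension.mk x₀ (q.1.1,
      unitLine ((unitMid, middleThird q.1.2), q.2))), q.1.2), by fun_prop⟩
    (ReducedSuspension.base x₀) (by
      rintro ⟨x, t⟩ (h | h | h) s
      · simp only at h
        subst h
        exact hC0 _ (hρ.mem_lower x (unitLine_mid_le (by simp)))
      · simp only at h
        subst h
        exact hC1 _ (hρ.mem_upper x (le_unitLine_mid (by simp; norm_num)))
      · simp only at h
        subst h
        simp only [ContinuousMap.coe_mk]
        rw [ReducedSuspension.mk_eq_base (p := (x, _)) (Or.inr (Or.inr rfl)), hρ.base, hCb])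
  have b1 : ∀ s, F₁ (ReducedSuspension.base x₀, s) = ReducedSuspension.base x₀ := fun s =>
    (hF₁ (x₀, 0) s).trans (hbase _ (Or.inr (Or.inr rfl)))
  have b2 : ∀ s, F₂ (ReducedSuspension.base x₀, s) = ReducedSuspension.base x₀ := fun s => by
    refine (hF₂ (x₀, 0) s).trans ?_
    simp only [ContinuousMap.coe_mk]
    rw [hbase (x₀, _) (Or.inr (Or.inr rfl)), hρ.base, hCb]
  have b3 : ∀ s, F₃ (ReducedSuspension.base x₀, s) = ReducedSuspension.base x₀ := fun s =>
    (hF₃ (x₀, 0) s).trans (hbase _ (Or.inr (Or.inr rfl)))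
  have step1 : GenLoop.Homotopic g (GenLoop.postcomp (F₁.comp ⟨fun w => (w, 1), by fun_prop⟩)
      (b1 1) g) :=
    GenLoop.homotopic_postcomp F₁ b1 (ContinuousMap.id _) _ rfl _ (fun w => by
      obtain ⟨p, rfl⟩ := ReducedSuspension.mk_surjective x₀ w
      rw [hF₁, unitLine_zero]; rfl) (fun w => rfl) g
  have step2 : GenLoop.Homotopic
      (GenLoop.postcomp (F₁.comp ⟨fun w => (w, 1), by fun_prop⟩) (b1 1) g)
      (GenLoop.postcomp (F₂.comp ⟨fun w => (w, 1), by fun_prop⟩) (b2 1) g) :=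
    GenLoop.homotopic_postcomp F₂ b2 _ _ _ _ (fun w => by
      obtain ⟨p, rfl⟩ := ReducedSuspension.mk_surjective x₀ w
      simp only [ContinuousMap.comp_apply, ContinuousMap.coe_mk]
      rw [hF₁, hF₂]
      simp only [ContinuousMap.coe_mk, unitLine_zero, unitLine_one, hρ.mid, hCθ]) (fun w => rfl) g
  have step3 : GenLoop.Homotopic
      (GenLoop.postcomp ((UnreducedSuspension.toReduced x₀).comp ρ) hb g)
      (GenLoop.postcomp (F₂.comp ⟨fun w => (w, 1), by fun_prop⟩) (b2 1) g) :=
    GenLoop.homotopic_postcomp (((UnreducedSuspension.toReduced x₀).comp ρ).comp F₃)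
      (fun s => by rw [ContinuousMap.comp_apply, b3, hb]) _ _ _ _ (fun w => by
        obtain ⟨p, rfl⟩ := ReducedSuspension.mk_surjective x₀ w
        simp only [ContinuousMap.comp_apply]
        rw [hF₃, unitLine_zero]) (fun w => by
        obtain ⟨⟨x, t⟩, rfl⟩ := ReducedSuspension.mk_surjective x₀ w
        simp only [ContinuousMap.comp_apply, ContinuousMap.coe_mk]
        rw [hF₃, hF₂]
        simp only [ContinuousMap.coe_mk, unitLine_one]
        rcases le_total (t : ℝ) (1 / 3) with h | h
        · rw [middleThird_of_le h, hbase (x, 0) (Or.inl rfl), hρ.base, hCb]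
          exact hbase _ (Or.inr (Or.inr rfl))
        rcases le_total (t : ℝ) (2 / 3) with h' | h'
        · rw [hCm _ _ h h']
        · rw [middleThird_of_ge h', hbase (x, 1) (Or.inr (Or.inl rfl)), hρ.base, hCb]
          exact hbase _ (Or.inr (Or.inr rfl))) g
  exact (step1.trans step2).trans step3.symm

/-- A loop in the reduced suspension, composed with the comparison map, is a family of paths. The
deformation to constant paths at midpoints becomes, under the closing map, a homotopy of loops that
ends at a reparametrized suspension. -/
theorem suspensionMap_surjective (hX : IsNConnected ((n : ℤ) - 1) X) (hk : k < 2 * n) :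
    Function.Surjective (suspensionMap k x₀) := by
  intro a
  induction a using Quotient.inductionOn with
  | h g =>
    have hb : (UnreducedSuspension.toReduced x₀).comp ρ (ReducedSuspension.base x₀) =
        ReducedSuspension.base x₀ := by
      rw [ContinuousMap.comp_apply, hρ.base]
      exact ReducedSuspension.mk_eq_base (Or.inr (Or.inr rfl))
    let Φ : C((Fin k → I) × I, UnreducedSuspension X) := ρ.comp (g.1.comp cubeSnoc)
    have hΦ : ∀ y t, (y ∈ Cube.boundary (Fin k) ∨ t = 0 ∨ t = 1) →
        Φ (y, t) = ρ (ReducedSuspension.base x₀) := fun y t h => by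
      refine congrArg ρ (g.2 _ (mem_boundary_succ.2 ?_))
      simpa only [cubeSnoc_last, cubeSnoc_castSucc] using h.symm
    obtain ⟨f, hfb, ⟨H⟩⟩ := exists_midpoint_family hX hk Φ
      (fun y => by rw [hΦ y 0 (Or.inr (Or.inl rfl))]; exact hρ.base_mem_lower)
      (fun y => by rw [hΦ y 1 (Or.inr (Or.inr rfl))]; exact hρ.base_mem_upper)
      (fun _ => x₀) (fun y hy t => by rw [hΦ y t (Or.inl hy), hρ.base])
    obtain ⟨C, hC0, hC1, hCm, hCb, θ, hθ0, hθ1, hCθ⟩ := exists_cap x₀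
    let f' : Ω^ (Fin k) X x₀ := ⟨f, hfb⟩
    refine ⟨⟦f'⟧, Quotient.sound (GenLoop.Homotopic.symm ?_)⟩
    have h1 := hρ.homotopic_toReduced g hb
    have h2 := GenLoop.homotopic_reparamLast middleThird middleThird_zero middleThird_one
      (GenLoop.postcomp ((UnreducedSuspension.toReduced x₀).comp ρ) hb g)
    have h4 := (GenLoop.homotopic_reparamLast θ hθ0 hθ1 (suspendGenLoop f')).symm
    refine ((h1.trans h2).trans ?_).trans h4
    refine GenLoop.homotopic_of_family ⟨fun q => C (H (q.1, (fun i => q.2 i.castSucc,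
      middleThird (q.2 (Fin.last k)))), q.2 (Fin.last k)), C.continuous.comp
        ((H.toHomotopy.continuous.comp (by fun_prop)).prodMk (by fun_prop))⟩
      (fun y => ?_) (fun y => ?_) (fun s y hy => ?_)
    · have hH := H.apply_zero ((fun i => y i.castSucc), middleThird (y (Fin.last k)))
      simp only [ContinuousMap.coe_mk, GenLoop.reparamLast_apply, GenLoop.postcomp_apply]
      rw [hH]
      rcases le_total (y (Fin.last k) : ℝ) (1 / 3) with h | h
      · rw [hΦ _ _ (Or.inr (Or.inl (middleThird_of_le h))), hρ.base, hCb]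
        rw [GenLoop.boundary g _ (mem_boundary_succ.2 (Or.inl (Or.inl (by
          rw [cubeSnoc_last]; exact middleThird_of_le h)))), hb]
      rcases le_total (y (Fin.last k) : ℝ) (2 / 3) with h' | h'
      · rw [hCm _ _ h h']
        rfl
      · rw [hΦ _ _ (Or.inr (Or.inr (middleThird_of_ge h'))), hρ.base, hCb]
        rw [GenLoop.boundary g _ (mem_boundary_succ.2 (Or.inl (Or.inr (by
          rw [cubeSnoc_last]; exact middleThird_of_ge h')))), hb]
    · have hH := H.apply_one ((fun i => y i.castSucc), middleThird (y (Fin.last k)))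
      simp only [ContinuousMap.coe_mk, GenLoop.reparamLast_apply, suspendGenLoop_apply,
        cubeSnoc_last, cubeSnoc_castSucc]
      rw [hH]
      exact hCθ _ _
    · obtain ⟨p0, p1, pb⟩ := H.prop' s
      simp only [ContinuousMap.coe_mk]
      rcases mem_boundary_succ.1 hy with (h | h) | h
      · rw [h, middleThird_zero]
        exact hC0 _ (p0 _)
      · rw [h, middleThird_one]
        exact hC1 _ (p1 _)
      · have : H (s, (fun i => y i.castSucc, middleThird (y (Fin.last k)))) =
            UnreducedSuspension.mk (x₀, unitMid) :=
          (pb _ h _).trans ((hΦ _ _ (Or.inl h)).trans hρ.base)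
        rw [this, hCb]

/-- A homotopy between suspended loops is turned into a family of paths with one more parameter.
Over the boundary of the parameter cube the paths are constant at midpoints over the values of the
two loops, so that its deformation to constant paths at midpoints is a homotopy between these loops.
-/
theorem suspensionMap_injective (hX : IsNConnected ((n : ℤ) - 1) X) (hk : k + 1 < 2 * n) :
    Function.Injective (suspensionMap k x₀) := by
  intro a a' haa
  induction a, a' using Quotient.inductionOn₂ with
  | h f f' =>
    obtain ⟨H⟩ : GenLoop.Homotopic (suspendGenLoop f) (suspendGenLoop f') := Quotient.exact haa
    let T : C(I, I) := ⟨fun s => Set.projIcc 0 1 zero_le_one (min (3 * (s : ℝ)) (3 - 3 * s)),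
      continuous_projIcc.comp (by fun_prop)⟩
    have hT0 : T 0 = 0 := Set.projIcc_of_le_left zero_le_one (by simp)
    have hT1 : T 1 = 0 := Set.projIcc_of_le_left zero_le_one (by norm_num)
    have hTm : ∀ s : I, 1 / 3 ≤ (s : ℝ) → (s : ℝ) ≤ 2 / 3 → T s = 1 := fun s h1 h2 =>
      Set.projIcc_of_right_le zero_le_one (le_min (by linarith) (by linarith))
    -- On the outer thirds the paths of the suspended loops grow from their midpoints; on the middle
    -- third the given homotopy is run through.
    let Φ : C((Fin (k + 1) → I) × I, UnreducedSuspension X) :=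
      ⟨fun q => ρ (H (middleThird (q.1 (Fin.last k)), cubeSnoc (fun i => q.1 i.castSucc,
        unitLine ((unitMid, q.2), T (q.1 (Fin.last k)))))), ρ.continuous.comp
          (H.toHomotopy.continuous.comp (by fun_prop))⟩
    have hHb : ∀ s (y : Fin (k + 1) → I), y ∈ Cube.boundary (Fin (k + 1)) →
        H (s, y) = ReducedSuspension.base x₀ := fun s y hy =>
      (H.eq_fst s hy).trans ((suspendGenLoop f).2 y hy)
    have hH0 : ∀ p : (Fin k → I) × I, H (0, cubeSnoc p) = ReducedSuspension.mk x₀ (f p.1, p.2) :=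
      fun p => by
        refine (H.apply_zero _).trans ((suspendGenLoop_apply f _).trans ?_)
        simp only [cubeSnoc_last, cubeSnoc_castSucc]
    have hH1 : ∀ p : (Fin k → I) × I, H (1, cubeSnoc p) = ReducedSuspension.mk x₀ (f' p.1, p.2) :=
      fun p => by
        refine (H.apply_one _).trans ((suspendGenLoop_apply f' _).trans ?_)
        simp only [cubeSnoc_last, cubeSnoc_castSucc]
    have hΦv : ∀ z t, Φ (z, t) = ρ (H (middleThird (z (Fin.last k)), cubeSnoc
        (fun i => z i.castSucc, unitLine ((unitMid, t), T (z (Fin.last k)))))) := fun z t => rfl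
    have hΦb : ∀ z t, (fun i => z i.castSucc) ∈ Cube.boundary (Fin k) →
        Φ (z, t) = UnreducedSuspension.mk (x₀, unitMid) := fun z t hz => by
      rw [hΦv, hHb _ _ (mem_boundary_succ.2 (Or.inr (by simpa only [cubeSnoc_castSucc] using hz))),
        hρ.base]
    have hf0 : ∀ z t, z (Fin.last k) = 0 →
        Φ (z, t) = UnreducedSuspension.mk (f fun i => z i.castSucc, unitMid) := fun z t hz => by
      rw [hΦv, hz, middleThird_zero, hH0, hT0, unitLine_zero, hρ.mid]
    have hf1 : ∀ z t, z (Fin.last k) = 1 →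
        Φ (z, t) = UnreducedSuspension.mk (f' fun i => z i.castSucc, unitMid) := fun z t hz => by
      rw [hΦv, hz, middleThird_one, hH1, hT1, unitLine_zero, hρ.mid]
    classical
    let φ : (Fin (k + 1) → I) → X := fun z => if z (Fin.last k) = 0 then f fun i => z i.castSucc
      else if z (Fin.last k) = 1 then f' fun i => z i.castSucc else x₀
    obtain ⟨G, hG, -⟩ := exists_midpoint_family hX hk Φ (fun z => by
        rw [hΦv]
        rcases le_total (z (Fin.last k) : ℝ) (1 / 3) with h | h
        · rw [middleThird_of_le h, hH0]
          exact hρ.mem_lower _ (unitLine_mid_le (by simp))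
        rcases le_total (z (Fin.last k) : ℝ) (2 / 3) with h' | h'
        · rw [hTm _ h h', unitLine_one, hHb _ _ (mem_boundary_succ.2 (Or.inl (Or.inl (by simp))))]
          exact hρ.base_mem_lower
        · rw [middleThird_of_ge h', hH1]
          exact hρ.mem_lower _ (unitLine_mid_le (by simp)))
      (fun z => by
        rw [hΦv]
        rcases le_total (z (Fin.last k) : ℝ) (1 / 3) with h | h
        · rw [middleThird_of_le h, hH0]
          exact hρ.mem_upper _ (le_unitLine_mid (by norm_num))
        rcases le_total (z (Fin.last k) : ℝ) (2 / 3) with h' | h'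
        · rw [hTm _ h h', unitLine_one, hHb _ _ (mem_boundary_succ.2 (Or.inl (Or.inr (by simp))))]
          exact hρ.base_mem_upper
        · rw [middleThird_of_ge h', hH1]
          exact hρ.mem_upper _ (le_unitLine_mid (by norm_num)))
      φ (fun z hz t => by
        simp only [φ]
        split_ifs with h0 h1
        · exact hf0 z t h0
        · exact hf1 z t h1
        · exact hΦb z t ((mem_boundary_succ.1 hz).resolve_left (not_or.2 ⟨h0, h1⟩)))
    refine Quotient.sound (GenLoop.homotopic_of_family ⟨fun q => G (cubeSnoc (q.2, q.1)),
      by fun_prop⟩ (fun y => ?_) (fun y => ?_) fun s y hy => ?_)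
    · simp only [ContinuousMap.coe_mk]
      rw [hG _ (mem_boundary_succ.2 (Or.inl (Or.inl (by simp))))]
      simp only [φ, cubeSnoc_last, if_true, cubeSnoc_castSucc]
    · simp only [ContinuousMap.coe_mk]
      rw [hG _ (mem_boundary_succ.2 (Or.inl (Or.inr (by simp))))]
      simp only [φ, cubeSnoc_last, one_ne_zero, if_false, if_true, cubeSnoc_castSucc]
    · simp only [ContinuousMap.coe_mk]
      rw [hG _ (mem_boundary_succ.2 (Or.inr (by simpa only [cubeSnoc_castSucc] using hy)))]
      simp only [φ, cubeSnoc_last, cubeSnoc_castSucc]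
      split_ifs
      · exact GenLoop.boundary f y hy
      · exact GenLoop.boundary f' y hy
      · rfl

end IsComparison

end Freudenthal

theorem mainTheorem7 {X : Type*} [TopologicalSpace X] [T2Space X]
    [Topology.CWComplex (Set.univ : Set X)] (x₀ : X) (n : ℕ)
    (hX : IsNConnected ((n : ℤ) - 1) X) :
    -- in positive degrees, `Σ` is a group homomorphism
    (∀ (k : ℕ) (a b : π_ (k + 1) X x₀),
      suspensionMap (k + 1) x₀ (a * b) =
        suspensionMap (k + 1) x₀ a * suspensionMap (k + 1) x₀ b) ∧
    (∀ k : ℕ, (k : ℤ) ≤ 2 * (n : ℤ) - 2 → Function.Bijective (suspensionMap k x₀)) ∧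
    (∀ k : ℕ, (k : ℤ) = 2 * (n : ℤ) - 1 → Function.Surjective (suspensionMap k x₀)) := by
  obtain ⟨R, hR, hR0, hR1⟩ := CWComplex.exists_retraction x₀
  obtain ⟨ρ, h1, h2, h3, h4⟩ := ReducedSuspension.exists_toUnreduced x₀ R hR hR0 hR1
  have hρ : IsComparison ρ := ⟨h1, h2, h3, h4⟩
  exact ⟨suspensionMap_mul x₀, fun k hk => ⟨hρ.suspensionMap_injective hX (by omega),
    hρ.suspensionMap_surjective hX (by omega)⟩,
    fun k hk => hρ.suspensionMap_surjective hX (by omega)⟩
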